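/- **Setting.** Let $A\in\mathbb R^{n\times n}$, $B_i\in\mathbb R^{n\times m_i}$, $C_i\in\mathbb R^{p_i\times n}$ ($i=1,2$), $f:\mathbb R^{p_1}\to\mathbb R^{m_1}$ and $\Delta\in\mathbb R^{m_1\times p_1}_+$. Assume that $A$ is Metzler (its off-diagonal entries are nonnegative), that $B_1,B_2,C_1,C_2$ are entrywise nonnegative, and that $|f(\zeta_1)-f(\zeta_2)|\le\Delta|\zeta_1-\zeta_2|$ for all $\zeta_1,\zeta_2\in\mathbb R^{p_1}$; inequalities and absolute values of vectors and matrices are componentwise. Consider the forced Lur'e system $$\dot x(t)=Ax(t)+B_1f(C_1x(t))+B_2w(t),\qquad y_2(t)=C_2x(t).\tag{L}$$ For $R=\mathbb R_+=[0,\infty)$ (resp. $R=\mathbb R$) let $\mathcal B$ (resp. $\mathcal B_{\rm bi}$) be the set of pairs $(w,x)$, called trajectories, with $w\in L^1_{\rm loc}(R,\mathbb R^{m_2})$ and $x:R\to\mathbb R^n$ locally absolutely continuous such that (L) holds a.e. on $R$. Assume: * (H1) there are $\xi>0$ and $p\in\mathbb R^n$ with all entries positive such that $p^\top(A+B_1\Delta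 C_1)\le-\xi p^\top$; * (P) there are $\eta\in\mathbb R^{p_1}$ with all entries positive and $\rho\in(0,1)$ such that $\eta^\top{\bf G}_{11}(0)\Delta\le\rho\,\eta^\top$, where ${\bf G}_{11}(0)=C_1(-A)^{-1}B_1$. Fix such $\xi,p$ and put $\tilde r:=B_2^\top p$. We also refer to * (H2) there are $\xi'>0$, $p'\in\mathbb R^n$ with all entries positive, and nonnegative vectors $l\in\mathbb R^n$, $q\in\mathbb R^{p_2}$, $r,k\in\mathbb R^{m_2}$ with $p'^\top(A+B_1\Delta C_1)+\xi'p'^\top+q^\top C_2+l^\top=0$ and $p'^\top B_2-r^\top+k^\top=0$. **Notation.** $|z|_r:=r^\top|z|$; $\|w\|_{S^1}:=\sup_{a\in R}\int_a^{a+1}\|w(t)\|\,dt$, and $\|w\|_{S^1_r}$ (on $\mathbb R_+$) and $\|w\|_{L^\infty(\mathbb R_+;r)}$ are the Stepanov and essential supremum seminorms formed with $|\cdot|_r$ in place of a norm. $(\sigma_\tau w)(t):=w(t+\tau)$. For continuous $z$ on $R$, $P(z,\varepsilon):=\{\tau\in R:\|z(t)-z(t+\tau)\|\le\varepsilon\ \forall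 t\in R\}$; $z\in AP(R)$ (Bohr almost periodic) if $P(z,\varepsilon)$ is relatively dense in $R$ for all $\varepsilon>0$, i.e. for some $l>0$ it meets $[a,a+l]$ for every $a\in R$. For $w\in L^1_{\rm loc}$, $P_1(w,\varepsilon):=\{\tau\in R:\|\sigma_\tau w-w\|_{S^1}\le\varepsilon\}$; $w\in S^1(R)$ (Stepanov almost periodic) if $P_1(w,\varepsilon)$ is relatively dense for all $\varepsilon>0$. For $\alpha\ge0$, $U_\alpha L^1_{\rm loc}$ is the set of $w\in L^1_{\rm loc}(\mathbb R_+)$ with $\|w\|_{S^1}<\infty$ and $\|\sigma_t({\rm e}^{\alpha\,\cdot}w)\|_{S^1}\to0$ as $t\to\infty$. $v\in AS^1$ with $v^{\rm s}=w$ means $w\in S^1(\mathbb R_+)$ and $v-w\in U_0L^1_{\rm loc}$; $v\in AAP$ with $v^{\rm ap}=w$ means $w\in AP(\mathbb R_+)$ and $v-w$ is continuous on $\mathbb R_+$ and tends to $0$ at $\infty$. For $z\in AP(\mathbb R_+)$, $z_{\rm e}\in AP(\mathbb R)$ is the extension of $z$ with $z_{\rm e}(t)=\lim_k z(t+\tau_k)$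 whenever $\tau_k\in P(z,1/k)$, $\tau_k\to\infty$; for $w\in S^1(\mathbb R_+)$, $w_{\rm e}\in S^1(\mathbb R)$ is the extension of $w$ (a.e.) that is the $L^1_{\rm loc}(\mathbb R)$-limit of $w(\cdot+\tau_k)$ whenever $\tau_k\in P_1(w,1/k)$, $\tau_k\to\infty$. **Proposition.** For every $w\in S^1(\mathbb R_+,\mathbb R^{m_2})$ there is a unique $z^{\rm ap}\in AP(\mathbb R_+,\mathbb R^n)$ with $(w,z^{\rm ap})\in\mathcal B$; moreover, for every $\varepsilon>0$ there is $\delta>0$ with $P_1(w,\delta)\subset P(z^{\rm ap},\varepsilon)$. Let $(v,x)\in\mathcal B$. 1. If $v\in AS^1$ with $v^{\rm s}=w$, then $x(t)-z^{\rm ap}(t)\to0$ as $t\to\infty$, that is, $x\in AAP$ with $x^{\rm ap}=z^{\rm ap}$. 2. The conclusion of 1 also holds in each of the following cases: (i) $w\in AP(\mathbb R_+)$ and $v\in AAP$ with $v^{\rm ap}=w$, and in this case also $v\in AS^1$ with $v^{\rm s}=w$; (ii) $v,w\in L^\infty(\mathbb R_+)$ and $\|v-w\|_{L^\infty(t,\infty)}\to0$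 as $t\to\infty$; (iii) $v-w\in L^1(\mathbb R_+)$. 3. If $v-w\in U_\alpha L^1_{\rm loc}$ for some $\alpha>0$, then $x-z^{\rm ap}\to0$ exponentially: $\|x(t)-z^{\rm ap}(t)\|\le M{\rm e}^{-\gamma t}$ for all $t\ge0$ and some $M$ and $\gamma>0$. 4. If $w$ is periodic with period $\tau>0$ (a.e. on $\mathbb R_+$), then $z^{\rm ap}$ is $\tau$-periodic. 5. The extensions $w_{\rm e}$ and $z^{\rm ap}_{\rm e}$ exist, $(w_{\rm e},z^{\rm ap}_{\rm e})\in\mathcal B_{\rm bi}$, and there is no other bounded $\hat x:\mathbb R\to\mathbb R^n$ with $(w_{\rm e},\hat x)\in\mathcal B_{\rm bi}$. 6. There are constants $\beta_0,c_1>0$, independent of the trajectories, such that, whenever $(v,x^{\rm ap}),(w,z^{\rm ap})\in\mathcal B$ with $v,w\in S^1(\mathbb R_+,\mathbb R^{m_2})$ and $x^{\rm ap},z^{\rm ap}\in AP(\mathbb R_+,\mathbb R^n)$, $$\|x^{\rm ap}-z^{\rm ap}\|_{L^\infty(\mathbb R_+;p)}\le\beta_0\|v-w\|_{S^1_{\tilde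 r}},$$ and, if additionally $v,w\in L^\infty(\mathbb R_+,\mathbb R^{m_2})$, for every $r\in\mathbb R^{m_2}$ with $r\ge\tilde r$ (in particular $r=\tilde r$) $$\|x^{\rm ap}-z^{\rm ap}\|_{L^\infty(\mathbb R_+;p)}\le c_1\|v-w\|_{L^\infty(\mathbb R_+;r)}.$$ 7. If (H2) holds with $\xi',p',l,q,r,k$, then there is $c_2>0$ such that, for all $(w_a,z_a),(w_b,z_b)\in\mathcal B$ with $w_a,w_b\in S^1(\mathbb R_+,\mathbb R^{m_2})$, $z_a,z_b\in AP(\mathbb R_+,\mathbb R^n)$ and $y_{2,j}:=C_2z_j$, $$\|y_{2,a}-y_{2,b}\|_{S^1_q}\le c_2\|w_a-w_b\|_{S^1_r}.$$ -/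

import Mathlib

open MeasureTheory Set Filter Topology Matrix
open scoped ENNReal

/-! Functions on `R = [0, ∞)` or `R = ℝ` are represented by functions `ℝ → E` together with the
set `R : Set ℝ` (`Ici 0` or `univ`); values outside `R` never matter. The norm on `Fin n → ℝ` is the
sup norm. Stepanov and essential-supremum norms take values in `ℝ≥0∞`. -/

section AlmostPeriodic

variable {n : ℕ}

/-- The weighted one-norm `|z|_r = rᵀ|z|` (a seminorm for `r ≥ 0`). -/
def wabs (r z : Fin n → ℝ) : ℝ := ∑ i, r i * |z i|

/-- The Stepanov norm `‖w‖_{S¹} = sup_{a ∈ R} ∫_a^{a+1} ‖w(t)‖ dt`. -/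
noncomputable def stepanovNorm (R : Set ℝ) (w : ℝ → Fin n → ℝ) : ℝ≥0∞ :=
  ⨆ a ∈ R, ∫⁻ t in Icc a (a + 1), ‖w t‖ₑ

/-- The weighted Stepanov (semi)norm `‖w‖_{S¹_r} = sup_{a ≥ 0} ∫_a^{a+1} |w(t)|_r dt` on `[0, ∞)`. -/
noncomputable def stepanovNormW (r : Fin n → ℝ) (w : ℝ → Fin n → ℝ) : ℝ≥0∞ :=
  ⨆ a ∈ Ici (0 : ℝ), ∫⁻ t in Icc a (a + 1), ENNReal.ofReal (wabs r (w t))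

/-- The weighted (semi)norm `‖w‖_{L^∞([0,∞); r)} = ess sup_{t ≥ 0} |w(t)|_r`. -/
noncomputable def linftyNormW (r : Fin n → ℝ) (w : ℝ → Fin n → ℝ) : ℝ≥0∞ :=
  essSup (fun t => ENNReal.ofReal (wabs r (w t))) (volume.restrict (Ici (0 : ℝ)))

/-- `P` is relatively dense in `R`: for some `l > 0`, every `[a, a + l]` with `a ∈ R` meets `P`. -/
def RelativelyDense (R P : Set ℝ) : Prop :=
  ∃ l : ℝ, 0 < l ∧ ∀ a ∈ R, (Icc a (a + l) ∩ P).Nonempty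

/-- The set `P(v, ε)` of `ε`-periods of `v` (in the sense of Bohr). -/
def bohrPeriods (R : Set ℝ) (v : ℝ → Fin n → ℝ) (ε : ℝ) : Set ℝ :=
  {τ | τ ∈ R ∧ ∀ t ∈ R, ‖v t - v (t + τ)‖ ≤ ε}

/-- `v ∈ AP(R, ℝⁿ)`: Bohr almost periodic functions. -/
def IsBohrAP (R : Set ℝ) (v : ℝ → Fin n → ℝ) : Prop :=
  ContinuousOn v R ∧ ∀ ε : ℝ, 0 < ε → RelativelyDense R (bohrPeriods R v ε)

/-- The set `P₁(w, ε)` of Stepanov `ε`-periods of `w`. -/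
def stepanovPeriods (R : Set ℝ) (w : ℝ → Fin n → ℝ) (ε : ℝ) : Set ℝ :=
  {τ | τ ∈ R ∧ stepanovNorm R (fun t => w (t + τ) - w t) ≤ ENNReal.ofReal ε}

/-- `w ∈ S¹(R, ℝⁿ)`: Stepanov almost periodic functions. -/
def IsStepanovAP (R : Set ℝ) (w : ℝ → Fin n → ℝ) : Prop :=
  LocallyIntegrableOn w R ∧ ∀ ε : ℝ, 0 < ε → RelativelyDense R (stepanovPeriods R w ε)

/-- `v ∈ AAP([0,∞), ℝⁿ)` with `v^ap = vap`: `vap` is Bohr almost periodic, and `v - vap` is continuous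
on `[0, ∞)` and tends to zero at infinity. -/
def HasBohrAPPart (v vap : ℝ → Fin n → ℝ) : Prop :=
  IsBohrAP (Ici 0) vap ∧ ContinuousOn (fun t => v t - vap t) (Ici 0) ∧
    Tendsto (fun t => v t - vap t) atTop (𝓝 0)

/-- `w ∈ U_α L¹_loc([0,∞), ℝⁿ)`: `w` is uniformly locally integrable and `‖σ_t(exp_α w)‖_{S¹} → 0` as
`t → ∞`. -/
def IsULocVanishing (α : ℝ) (w : ℝ → Fin n → ℝ) : Prop :=
  LocallyIntegrableOn w (Ici 0) ∧ stepanovNorm (Ici 0) w < ∞ ∧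
    Tendsto (fun t : ℝ => stepanovNorm (Ici 0) (fun θ => Real.exp (α * (θ + t)) • w (θ + t)))
      atTop (𝓝 0)

/-- `v ∈ AS¹([0,∞), ℝⁿ)` with `v^s = vs`: `vs` is Stepanov almost periodic and
`v - vs ∈ U_0 L¹_loc`. -/
def HasStepanovAPPart (v vs : ℝ → Fin n → ℝ) : Prop :=
  IsStepanovAP (Ici 0) vs ∧ IsULocVanishing 0 (fun t => v t - vs t)

/-- `ve` is the extension `v_e ∈ AP(ℝ, ℝⁿ)` of `v ∈ AP([0,∞), ℝⁿ)`, `v_e(t) = lim_k v(t + τ_k)` for all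
`τ_k ∈ P(v, 1/k)` with `τ_k → ∞`. -/
def IsBohrExtension (v ve : ℝ → Fin n → ℝ) : Prop :=
  IsBohrAP univ ve ∧ EqOn ve v (Ici 0) ∧
    ∀ τ : ℕ → ℝ, (∀ k : ℕ, τ k ∈ bohrPeriods (Ici 0) v (1 / ((k : ℝ) + 1))) →
      Tendsto τ atTop atTop → ∀ t : ℝ, Tendsto (fun k => v (t + τ k)) atTop (𝓝 (ve t))

/-- `we` is the extension `w_e ∈ S¹(ℝ, ℝⁿ)` of `w ∈ S¹([0,∞), ℝⁿ)`, the limit in `L¹_loc(ℝ, ℝⁿ)` of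
`w(· + τ_k)` for all `τ_k ∈ P₁(w, 1/k)` with `τ_k → ∞`. -/
def IsStepanovExtension (w we : ℝ → Fin n → ℝ) : Prop :=
  IsStepanovAP univ we ∧ (∀ᵐ t ∂(volume.restrict (Ici (0 : ℝ))), we t = w t) ∧
    ∀ τ : ℕ → ℝ, (∀ k : ℕ, τ k ∈ stepanovPeriods (Ici 0) w (1 / ((k : ℝ) + 1))) →
      Tendsto τ atTop atTop → ∀ a b : ℝ,
        Tendsto (fun k => ∫⁻ t in Icc a b, ‖w (t + τ k) - we t‖ₑ) atTop (𝓝 0)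

end AlmostPeriodic

/-- The data of a forced four-block Lur'e system
`ẋ = A x + B₁ f(C₁ x) + B₂ w`, `y₁ = C₁ x`, `y₂ = C₂ x`,
together with the matrix `Δ` of the incremental bound on `f`. -/
structure LureSystem (n m₁ m₂ p₁ p₂ : ℕ) where
  A : Matrix (Fin n) (Fin n) ℝ
  B₁ : Matrix (Fin n) (Fin m₁) ℝ
  B₂ : Matrix (Fin n) (Fin m₂) ℝ
  C₁ : Matrix (Fin p₁) (Fin n) ℝ
  C₂ : Matrix (Fin p₂) (Fin n) ℝ
  f : (Fin p₁ → ℝ) → (Fin m₁ → ℝ)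
  Δ : Matrix (Fin m₁) (Fin p₁) ℝ

namespace LureSystem

variable {n m₁ m₂ p₁ p₂ : ℕ} (S : LureSystem n m₁ m₂ p₁ p₂)

/-- `A` is Metzler, and `B₁, B₂, C₁, C₂` are nonnegative. -/
def IsPositive : Prop :=
  (∀ i j, i ≠ j → 0 ≤ S.A i j) ∧ (∀ i j, 0 ≤ S.B₁ i j) ∧ (∀ i j, 0 ≤ S.B₂ i j) ∧
    (∀ i j, 0 ≤ S.C₁ i j) ∧ (∀ i j, 0 ≤ S.C₂ i j)

/-- `Δ ≥ 0` and `|f(ζ₁) - f(ζ₂)| ≤ Δ |ζ₁ - ζ₂|` componentwise. -/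
def IncrementalBound : Prop :=
  (∀ i j, 0 ≤ S.Δ i j) ∧
    ∀ ζ₁ ζ₂ : Fin p₁ → ℝ, ∀ i, |S.f ζ₁ i - S.f ζ₂ i| ≤ ∑ j, S.Δ i j * |ζ₁ j - ζ₂ j|

/-- Hypothesis (H1) with the constant `ξ` and the vector `p`. -/
def H1 (ξ : ℝ) (p : Fin n → ℝ) : Prop :=
  0 < ξ ∧ (∀ i, 0 < p i) ∧ p ᵥ* (S.A + S.B₁ * S.Δ * S.C₁) ≤ -(ξ • p)

/-- Hypothesis (H2) with the constant `ξ` and the vectors `p, l, q, r, k`. -/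
def H2 (ξ : ℝ) (p l : Fin n → ℝ) (q : Fin p₂ → ℝ) (r k : Fin m₂ → ℝ) : Prop :=
  0 < ξ ∧ (∀ i, 0 < p i) ∧ 0 ≤ l ∧ 0 ≤ q ∧ 0 ≤ r ∧ 0 ≤ k ∧
    p ᵥ* (S.A + S.B₁ * S.Δ * S.C₁) + ξ • p + q ᵥ* S.C₂ + l = 0 ∧
    p ᵥ* S.B₂ - r + k = 0

/-- The transfer function `G₁₁(s) = C₁ (s I - A)⁻¹ B₁` at real `s`. -/
noncomputable def G₁₁ (s : ℝ) : Matrix (Fin p₁) (Fin m₁) ℝ :=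
  S.C₁ * (s • (1 : Matrix (Fin n) (Fin n) ℝ) - S.A)⁻¹ * S.B₁

/-- The Perron-type condition `vᵀ G₁₁(0) Δ ≤ ρ vᵀ` with strictly positive `v` and `ρ ∈ (0, 1)`. -/
def PerronCondition (ρ : ℝ) (v : Fin p₁ → ℝ) : Prop :=
  0 < ρ ∧ ρ < 1 ∧ (∀ i, 0 < v i) ∧ v ᵥ* (S.G₁₁ 0 * S.Δ) ≤ ρ • v

/-- `(w, x)` is a trajectory on `R` (`R = [0, ∞)`: the behaviour; `R = ℝ`: the bilateral behaviour):
`w` is locally integrable, `x` is locally absolutely continuous, and the differential equation holds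
almost everywhere on `R`. -/
def IsTrajectory (R : Set ℝ) (w : ℝ → Fin m₂ → ℝ) (x : ℝ → Fin n → ℝ) : Prop :=
  LocallyIntegrableOn w R ∧
    (∀ a ∈ R, ∀ b ∈ R, AbsolutelyContinuousOnInterval x a b) ∧
    ∀ᵐ t ∂(volume.restrict R),
      HasDerivAt x (S.A *ᵥ x t + S.B₁ *ᵥ S.f (S.C₁ *ᵥ x t) + S.B₂ *ᵥ w t) t

end LureSystem

/-!
The theorem rests on one comparison estimate. Adding a large multiple of the identity to the Metzler
matrix `A` makes it nonnegative, and then increments of the vector field are dominated entrywise by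
the positive linear system with matrix `A + B₁ Δ C₁`, of which `p` is a strict linear Lyapunov
function (`LureSystem.wabs_field_sub_le`). Consequently the weighted one-norm `V = wabs p (x - z)`
of the difference of two trajectories satisfies `V' ≤ -ξ V + wabs (p ᵥ* B₂) (v - w)` almost
everywhere. Integration over intervals of length one bounds `V(t)` by `exp (-ξ (t - s)) V(s)` plus a
multiple of the Stepanov norm of `v - w` on `[s, ∞)` (`LureSystem.wabs_le_exp_add`). This gives
convergence of trajectories, with an exponential rate when the inputs approach each other
exponentially. On `ℝ`, letting `s → -∞` removes the initial value: a bounded trajectory is determined by its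
input, and its translates differ by at most a multiple of the Stepanov distance of the
translated inputs.

The almost periodic trajectory is first constructed on `ℝ`. A Stepanov almost periodic input on the
half-line extends to `ℝ` as an almost everywhere limit of translates by almost periods, and by
Fatou's lemma keeps its almost periods (`IsStepanovAP.exists_extension`). For this extended
input a bounded trajectory is a fixed point of
`y ↦ ∫_{-∞}^t exp (-c (t - θ)) (c y + A y + B₁ f(C₁ y) + B₂ w)(θ) dθ`, and for large `c` the
comparison estimate makes this map a contraction with constant `(c - ξ) / c` for the supremum of
`wabs p` (`LureSystem.exists_bounded_trajectory`). The translation estimate shows that the fixed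
point is almost periodic, and periodic if the input is.

Uniqueness among almost periodic trajectories on the half-line, and the gain estimates, follow since
two almost periodic functions return simultaneously close to their values at arbitrarily late times
(`IsBohrAP.exists_common_recurrence`), so that the exponentially decaying initial term drops out of
the stability estimate. For the output estimate, the part `qᵀ C₂ |x - z|` of the dissipation is kept
and integrated over one unit interval.
-/

/-! ### Weighted one-norms -/

section Wabs

variable {n : ℕ}

lemma wabs_eq_dotProduct (r z : Fin n → ℝ) : wabs r z = r ⬝ᵥ |z| := rfl

lemma wabs_nonneg {r : Fin n → ℝ} (hr : 0 ≤ r) (z : Fin n → ℝ) : 0 ≤ wabs r z :=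
  Finset.sum_nonneg fun i _ => mul_nonneg (hr i) (abs_nonneg _)

lemma wabs_zero (r : Fin n → ℝ) : wabs r 0 = 0 := by simp [wabs]

lemma wabs_le_norm {r : Fin n → ℝ} (hr : 0 ≤ r) (z : Fin n → ℝ) :
    wabs r z ≤ (∑ i, r i) * ‖z‖ := by
  rw [wabs, Finset.sum_mul]
  exact Finset.sum_le_sum fun i _ => mul_le_mul_of_nonneg_left (norm_le_pi_norm z i) (hr i)

lemma exists_norm_le_wabs {p : Fin n → ℝ} (hp : ∀ i, 0 < p i) :
    ∃ C : ℝ, 0 < C ∧ ∀ z : Fin n → ℝ, ‖z‖ ≤ C * wabs p z := by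
  have h0 : 0 ≤ ∑ i, (p i)⁻¹ := Finset.sum_nonneg fun i _ => (inv_pos.2 (hp i)).le
  refine ⟨∑ i, (p i)⁻¹ + 1, by positivity, fun z => ?_⟩
  have hw := wabs_nonneg (fun i => (hp i).le) z
  refine (pi_norm_le_iff_of_nonneg (by positivity)).2 fun i => ?_
  have h1 : p i * |z i| ≤ wabs p z :=
    Finset.single_le_sum (f := fun i => p i * |z i|)
      (fun i _ => mul_nonneg (hp i).le (abs_nonneg _)) (Finset.mem_univ i)
  have h2 : (p i)⁻¹ ≤ ∑ i, (p i)⁻¹ + 1 := by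
    have := Finset.single_le_sum (f := fun i => (p i)⁻¹)
      (fun i _ => (inv_pos.2 (hp i)).le) (Finset.mem_univ i)
    linarith
  calc ‖z i‖ = (p i)⁻¹ * (p i * |z i|) := by
        rw [inv_mul_cancel_left₀ (hp i).ne', Real.norm_eq_abs]
    _ ≤ _ := mul_le_mul h2 h1 (mul_nonneg (hp i).le (abs_nonneg _)) (by positivity)

lemma wabs_mono {r s : Fin n → ℝ} (h : r ≤ s) (z : Fin n → ℝ) : wabs r z ≤ wabs s z :=
  Finset.sum_le_sum fun i _ => mul_le_mul_of_nonneg_right (h i) (abs_nonneg _)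

lemma wabs_smul (c : ℝ) (r z : Fin n → ℝ) : wabs (c • r) z = c * wabs r z := by
  simp [wabs_eq_dotProduct]

lemma wabs_smul_right (c : ℝ) (r z : Fin n → ℝ) : wabs r (c • z) = |c| * wabs r z := by
  simp only [wabs, Finset.mul_sum, Pi.smul_apply, smul_eq_mul, abs_mul]
  exact Finset.sum_congr rfl fun i _ => by ring

lemma wabs_add_le {r : Fin n → ℝ} (hr : 0 ≤ r) (x z : Fin n → ℝ) :
    wabs r (x + z) ≤ wabs r x + wabs r z := by
  simp only [wabs, ← Finset.sum_add_distrib, ← mul_add]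
  exact Finset.sum_le_sum fun i _ => mul_le_mul_of_nonneg_left (abs_add_le _ _) (hr i)

lemma continuous_wabs (r : Fin n → ℝ) : Continuous (wabs r) := by
  unfold wabs; fun_prop

end Wabs

lemma abs_mulVec_le {m n : ℕ} {N : Matrix (Fin m) (Fin n) ℝ} (hN : ∀ i j, 0 ≤ N i j)
    (e : Fin n → ℝ) : |N *ᵥ e| ≤ N *ᵥ |e| := by
  intro i
  simp only [Pi.abs_apply, mulVec, dotProduct]
  refine (Finset.abs_sum_le_sum_abs _ _).trans (Finset.sum_le_sum fun j _ => ?_)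
  rw [abs_mul, abs_of_nonneg (hN i j)]

lemma mulVec_le_mulVec_of_nonneg {m n : ℕ} {N : Matrix (Fin m) (Fin n) ℝ} (hN : ∀ i j, 0 ≤ N i j)
    {e e' : Fin n → ℝ} (h : e ≤ e') : N *ᵥ e ≤ N *ᵥ e' := fun i =>
  dotProduct_le_dotProduct_of_nonneg_left h (hN i)

lemma vecMul_nonneg {m n : ℕ} {N : Matrix (Fin m) (Fin n) ℝ} (hN : ∀ i j, 0 ≤ N i j)
    {p : Fin m → ℝ} (hp : 0 ≤ p) : 0 ≤ p ᵥ* N := fun j =>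
  dotProduct_nonneg_of_nonneg hp fun i => hN i j

lemma wabs_mulVec_le {m n : ℕ} {N : Matrix (Fin m) (Fin n) ℝ} (hN : ∀ i j, 0 ≤ N i j)
    {q : Fin m → ℝ} (hq : 0 ≤ q) (e : Fin n → ℝ) : wabs q (N *ᵥ e) ≤ wabs (q ᵥ* N) e := by
  rw [wabs_eq_dotProduct, wabs_eq_dotProduct, ← dotProduct_mulVec]
  exact dotProduct_le_dotProduct_of_nonneg_left (abs_mulVec_le hN e) hq

/-! ### The vector field of the Lur'e system -/

namespace LureSystem

variable {n m₁ m₂ p₁ p₂ : ℕ} (S : LureSystem n m₁ m₂ p₁ p₂)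

/-- The right-hand side `A x + B₁ f(C₁ x) + B₂ u` of the Lur'e system. -/
def field (x : Fin n → ℝ) (u : Fin m₂ → ℝ) : Fin n → ℝ :=
  S.A *ᵥ x + S.B₁ *ᵥ S.f (S.C₁ *ᵥ x) + S.B₂ *ᵥ u

variable {S}

/-- The comparison estimate behind everything: after adding a multiple `c` of the state that makes
`A + c I` nonnegative, increments of the vector field are bounded entrywise by a positive linear
system, so the weight `p` measures them through `pᵀ(A + B₁ Δ C₁) ≤ -sᵀ`. -/
lemma wabs_field_sub_le (hpos : S.IsPositive) (hf : S.IncrementalBound)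
    {p s : Fin n → ℝ} (hp : 0 ≤ p) (hps : p ᵥ* (S.A + S.B₁ * S.Δ * S.C₁) ≤ -s)
    {c : ℝ} (hc : ∀ i, 0 ≤ c + S.A i i) (x z : Fin n → ℝ) (u v : Fin m₂ → ℝ) :
    wabs p (c • (x - z) + (S.field x u - S.field z v)) ≤
      c * wabs p (x - z) - wabs s (x - z) + wabs (p ᵥ* S.B₂) (u - v) := by
  obtain ⟨hA, hB₁, hB₂, hC₁, -⟩ := hpos
  obtain ⟨hΔ, hf⟩ := hf
  set e := x - z with he
  have hN : ∀ i j, 0 ≤ (c • (1 : Matrix (Fin n) (Fin n) ℝ) + S.A) i j := by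
    intro i j
    rcases eq_or_ne i j with rfl | hij
    · simpa using hc i
    · simpa [hij] using hA i j hij
  have hsplit : c • e + (S.field x u - S.field z v) =
      (c • (1 : Matrix (Fin n) (Fin n) ℝ) + S.A) *ᵥ e +
        S.B₁ *ᵥ (S.f (S.C₁ *ᵥ x) - S.f (S.C₁ *ᵥ z)) + S.B₂ *ᵥ (u - v) := by
    rw [add_mulVec, smul_mulVec, one_mulVec, he]
    simp only [field, mulVec_sub]
    abel
  have hF : |S.f (S.C₁ *ᵥ x) - S.f (S.C₁ *ᵥ z)| ≤ S.Δ *ᵥ (S.C₁ *ᵥ |e|) := by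
    intro i
    refine (hf _ _ i).trans ?_
    change (S.Δ *ᵥ |S.C₁ *ᵥ x - S.C₁ *ᵥ z|) i ≤ _
    rw [← mulVec_sub]
    exact mulVec_le_mulVec_of_nonneg hΔ (abs_mulVec_le hC₁ e) i
  have h1 : |S.B₁ *ᵥ (S.f (S.C₁ *ᵥ x) - S.f (S.C₁ *ᵥ z))| ≤ (S.B₁ * S.Δ * S.C₁) *ᵥ |e| := by
    refine (abs_mulVec_le hB₁ _).trans ?_
    rw [Matrix.mul_assoc, ← mulVec_mulVec, ← mulVec_mulVec]
    exact mulVec_le_mulVec_of_nonneg hB₁ hF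
  have h2 : |c • e + (S.field x u - S.field z v)| ≤
      c • |e| + (S.A + S.B₁ * S.Δ * S.C₁) *ᵥ |e| + S.B₂ *ᵥ |u - v| := by
    have h3 := abs_mulVec_le hN e
    have h4 := abs_mulVec_le hB₂ (u - v)
    rw [add_mulVec, smul_mulVec, one_mulVec] at h3
    rw [hsplit, add_mulVec]
    intro i
    have h3i := h3 i
    have h4i := h4 i
    have h1i := h1 i
    simp only [Pi.add_apply, Pi.abs_apply, add_mulVec, smul_mulVec, one_mulVec] at *
    have := abs_add_three ((c • e) i + (S.A *ᵥ e) i)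
      ((S.B₁ *ᵥ (S.f (S.C₁ *ᵥ x) - S.f (S.C₁ *ᵥ z))) i) ((S.B₂ *ᵥ (u - v)) i)
    linarith
  have h5 := dotProduct_le_dotProduct_of_nonneg_left h2 hp
  have h6 := dotProduct_le_dotProduct_of_nonneg_right hps (abs_nonneg e)
  rw [dotProduct_add, dotProduct_add, dotProduct_mulVec, dotProduct_mulVec, dotProduct_smul] at h5
  rw [neg_dotProduct] at h6
  simp only [wabs_eq_dotProduct, smul_eq_mul] at *
  linarith

end LureSystem

/-! ### Absolutely continuous functions -/

section AbsolutelyContinuous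

lemma LipschitzWith.comp_absolutelyContinuousOnInterval {X Y : Type*} [PseudoMetricSpace X]
    [PseudoMetricSpace Y] {K : NNReal} {F : X → Y} (hF : LipschitzWith K F) {f : ℝ → X} {a b : ℝ}
    (hf : AbsolutelyContinuousOnInterval f a b) :
    AbsolutelyContinuousOnInterval (fun t => F (f t)) a b := by
  unfold AbsolutelyContinuousOnInterval at *
  refine squeeze_zero (fun E => Finset.sum_nonneg fun i _ => dist_nonneg) (fun E => ?_)
    (by simpa using hf.const_mul (K : ℝ))
  rw [Finset.mul_sum]
  exact Finset.sum_le_sum fun i _ => hF.dist_le_mul _ _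

lemma AbsolutelyContinuousOnInterval.of_eval {n : ℕ} {f : ℝ → Fin n → ℝ} {a b : ℝ}
    (hf : ∀ i, AbsolutelyContinuousOnInterval (fun t => f t i) a b) :
    AbsolutelyContinuousOnInterval f a b := by
  unfold AbsolutelyContinuousOnInterval at *
  refine squeeze_zero (fun E => Finset.sum_nonneg fun i _ => dist_nonneg) (fun E => ?_)
    (by simpa using tendsto_finsetSum Finset.univ fun i _ => hf i)
  rw [Finset.sum_comm]
  refine Finset.sum_le_sum fun k _ => ?_
  exact (dist_pi_le_iff (Finset.sum_nonneg fun i _ => dist_nonneg)).2 fun i =>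
    Finset.single_le_sum (f := fun i => dist (f (E.2 k).1 i) (f (E.2 k).2 i))
      (fun i _ => dist_nonneg) (Finset.mem_univ i)

lemma AbsolutelyContinuousOnInterval.comp_add_right {X : Type*} [PseudoMetricSpace X]
    {f : ℝ → X} {a b τ : ℝ} (hf : AbsolutelyContinuousOnInterval f (a + τ) (b + τ)) :
    AbsolutelyContinuousOnInterval (fun t => f (t + τ)) a b := by
  rw [absolutelyContinuousOnInterval_iff] at *
  intro ε hε
  obtain ⟨δ, hδ, h⟩ := hf ε hε
  refine ⟨δ, hδ, fun E hE hE' => ?_⟩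
  refine h (E.1, fun i => ((E.2 i).1 + τ, (E.2 i).2 + τ)) ⟨?_, ?_⟩ ?_
  · intro i hi
    have := hE.1 i hi
    rw [← image_add_const_uIcc]
    exact ⟨mem_image_of_mem _ this.1, mem_image_of_mem _ this.2⟩
  · intro i hi j hj hij
    have h1 := hE.2 hi hj hij
    have h2 : ∀ c d : ℝ, uIoc (c + τ) (d + τ) = (· + τ) '' uIoc c d := by
      intro c d
      simp [uIoc, min_add_add_right, max_add_add_right]
    simp only [Function.onFun, h2]
    exact (disjoint_image_iff (add_left_injective τ)).2 h1
  · simpa using hE'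

lemma AbsolutelyContinuousOnInterval.sub_le_integral {f g : ℝ → ℝ} {a b : ℝ} (hab : a ≤ b)
    (hf : AbsolutelyContinuousOnInterval f a b) (hg : IntervalIntegrable g volume a b)
    (h : ∀ᵐ t, t ∈ Icc a b → deriv f t ≤ g t) : f b - f a ≤ ∫ t in a..b, g t := by
  rw [← hf.integral_deriv_eq_sub]
  refine intervalIntegral.integral_mono_ae_restrict hab hf.intervalIntegrable_deriv hg ?_
  exact (ae_restrict_iff' measurableSet_Icc).2 h

/-- If `g' = -c g + h` at `t`, then `|g|' ≤ -c |g| + |h|` there. At a zero of `g`, the only place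
where `|g|` may fail to be differentiable, `|g|` has a minimum and `deriv` is zero. -/
lemma deriv_abs_le_of_hasDerivAt {g : ℝ → ℝ} {c h t : ℝ} (hg : HasDerivAt g (-c * g t + h) t) :
    deriv (fun θ => |g θ|) t ≤ -c * |g t| + |h| := by
  rcases lt_trichotomy (g t) 0 with h0 | h0 | h0
  · have : HasDerivAt (fun θ => |g θ|) (-1 * (-c * g t + h)) t := (hasDerivAt_abs_neg h0).comp t hg
    rw [this.deriv, abs_of_neg h0]
    linarith [neg_abs_le h]
  · have hmin : IsLocalMin (fun θ => |g θ|) t :=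
      Filter.Eventually.of_forall fun θ => by simp [h0]
    rw [hmin.deriv_eq_zero, h0]
    simp
  · have : HasDerivAt (fun θ => |g θ|) (1 * (-c * g t + h)) t := (hasDerivAt_abs_pos h0).comp t hg
    rw [this.deriv, abs_of_pos h0]
    linarith [le_abs_self h]

end AbsolutelyContinuous

/-! ### Dissipation along pairs of trajectories -/

namespace LureSystem

variable {n m₁ m₂ p₁ p₂ : ℕ} {S : LureSystem n m₁ m₂ p₁ p₂}

lemma IsTrajectory.mono {R R' : Set ℝ} (hR : R' ⊆ R) {w : ℝ → Fin m₂ → ℝ}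
    {x : ℝ → Fin n → ℝ} (h : S.IsTrajectory R w x) : S.IsTrajectory R' w x :=
  ⟨h.1.mono_set hR, fun a ha b hb => h.2.1 a (hR ha) b (hR hb),
    ae_mono (Measure.restrict_mono_set _ hR) h.2.2⟩

lemma exists_shift (S : LureSystem n m₁ m₂ p₁ p₂) : ∃ c : ℝ, ∀ i, 0 ≤ c + S.A i i := by
  refine ⟨∑ i, |S.A i i|, fun i => ?_⟩
  have := Finset.single_le_sum (f := fun i => |S.A i i|) (fun i _ => abs_nonneg _)
    (Finset.mem_univ i)
  linarith [neg_abs_le (S.A i i)]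

lemma _root_.absolutelyContinuousOnInterval_wabs {p : Fin n → ℝ} (hp : 0 ≤ p) {e : ℝ → Fin n → ℝ}
    {a b : ℝ} (he : AbsolutelyContinuousOnInterval e a b) :
    AbsolutelyContinuousOnInterval (fun t => wabs p (e t)) a b := by
  have hL : LipschitzWith (Real.toNNReal (∑ i, p i)) (wabs p) := by
    refine LipschitzWith.of_le_add_mul _ fun x y => ?_
    rw [Real.coe_toNNReal _ (Finset.sum_nonneg fun i _ => hp i), dist_eq_norm]
    have h1 := wabs_add_le hp y (x - y)
    rw [add_sub_cancel] at h1
    exact h1.trans (add_le_add_right (wabs_le_norm hp _) _)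
  exact hL.comp_absolutelyContinuousOnInterval he

/-- The dissipation inequality in differential form: the weighted distance of two trajectories
decreases at least at the rate `wabs s`, up to the weighted distance of the inputs. -/
lemma ae_deriv_wabs_le (hpos : S.IsPositive) (hf : S.IncrementalBound)
    {p s : Fin n → ℝ} (hp : 0 ≤ p) (hps : p ᵥ* (S.A + S.B₁ * S.Δ * S.C₁) ≤ -s) {a b : ℝ}
    (hab : a ≤ b) {u v : ℝ → Fin m₂ → ℝ} {x z : ℝ → Fin n → ℝ}
    (hx : S.IsTrajectory (Icc a b) u x) (hz : S.IsTrajectory (Icc a b) v z) :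
    ∀ᵐ t, t ∈ Icc a b → DifferentiableAt ℝ (fun t => wabs p (x t - z t)) t ∧
      deriv (fun t => wabs p (x t - z t)) t ≤
        -wabs s (x t - z t) + wabs (p ᵥ* S.B₂) (u t - v t) := by
  obtain ⟨c, hc⟩ := S.exists_shift
  have hac : AbsolutelyContinuousOnInterval (fun t => x t - z t) a b :=
    (hx.2.1 a (left_mem_Icc.2 hab) b (right_mem_Icc.2 hab)).fun_sub
      (hz.2.1 a (left_mem_Icc.2 hab) b (right_mem_Icc.2 hab))
  have hd : ∀ᵐ t, ∀ i, t ∈ Icc a b → DifferentiableAt ℝ (fun t => |(x t - z t) i|) t := by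
    refine ae_all_iff.2 fun i => ?_
    have h1 : LipschitzWith 1 fun y : Fin n → ℝ => y i := LipschitzWith.eval i
    have h2 : LipschitzWith 1 fun y : ℝ => |y| := lipschitzWith_one_norm
    have h3 := (h2.comp_absolutelyContinuousOnInterval
      (h1.comp_absolutelyContinuousOnInterval hac)).ae_differentiableAt
    rwa [uIcc_of_le hab] at h3
  have hx' := (ae_restrict_iff' measurableSet_Icc).1 hx.2.2
  have hz' := (ae_restrict_iff' measurableSet_Icc).1 hz.2.2
  filter_upwards [hd, hx', hz'] with t hd hx' hz' ht
  set h := c • (x t - z t) + (S.field (x t) (u t) - S.field (z t) (v t)) with hh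
  have hder : HasDerivAt (fun t => wabs p (x t - z t))
      (∑ i, p i * deriv (fun t => |(x t - z t) i|) t) t :=
    HasDerivAt.fun_sum fun i _ => ((hd i ht).hasDerivAt.const_mul (p i))
  refine ⟨hder.differentiableAt, ?_⟩
  rw [hder.deriv]
  have hi : ∀ i, deriv (fun t => |(x t - z t) i|) t ≤ -c * |(x t - z t) i| + |h i| := by
    intro i
    have h1 := hasDerivAt_pi.1 ((hx' ht).fun_sub (hz' ht)) i
    refine deriv_abs_le_of_hasDerivAt (g := fun t => (x t - z t) i) (h1.congr_deriv ?_)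
    simp only [hh, field, Pi.add_apply, Pi.sub_apply, Pi.smul_apply, smul_eq_mul]
    ring
  calc ∑ i, p i * deriv (fun t => |(x t - z t) i|) t
      ≤ ∑ i, p i * (-c * |(x t - z t) i| + |h i|) :=
        Finset.sum_le_sum fun i _ => mul_le_mul_of_nonneg_left (hi i) (hp i)
    _ = -c * wabs p (x t - z t) + wabs p h := by
        simp only [wabs, Finset.mul_sum, ← Finset.sum_add_distrib]
        exact Finset.sum_congr rfl fun i _ => by ring
    _ ≤ _ := by
        have := wabs_field_sub_le hpos hf hp hps hc (x t) (z t) (u t) (v t)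
        linarith

lemma _root_.integrableOn_wabs {m : ℕ} {r : Fin m → ℝ} {u : ℝ → Fin m → ℝ} {s : Set ℝ}
    (hu : IntegrableOn u s) : IntegrableOn (fun t => wabs r (u t)) s := by
  unfold wabs
  refine integrable_finsetSum _ fun i _ => Integrable.const_mul ?_ _
  exact (Integrable.eval hu i).abs

lemma IsTrajectory.integrableOn_sub {a b : ℝ} {u v : ℝ → Fin m₂ → ℝ} {x z : ℝ → Fin n → ℝ}
    (hx : S.IsTrajectory (Icc a b) u x) (hz : S.IsTrajectory (Icc a b) v z) :
    IntegrableOn (fun t => u t - v t) (Icc a b) :=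
  (hx.1.integrableOn_isCompact isCompact_Icc).sub (hz.1.integrableOn_isCompact isCompact_Icc)

/-- The dissipation inequality in integral form. -/
lemma wabs_add_integral_le (hpos : S.IsPositive) (hf : S.IncrementalBound)
    {p s : Fin n → ℝ} (hp : 0 ≤ p) (hps : p ᵥ* (S.A + S.B₁ * S.Δ * S.C₁) ≤ -s) {a b : ℝ}
    (hab : a ≤ b) {u v : ℝ → Fin m₂ → ℝ} {x z : ℝ → Fin n → ℝ}
    (hx : S.IsTrajectory (Icc a b) u x) (hz : S.IsTrajectory (Icc a b) v z) :
    wabs p (x b - z b) + ∫ t in a..b, wabs s (x t - z t) ≤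
      wabs p (x a - z a) + ∫ t in a..b, wabs (p ᵥ* S.B₂) (u t - v t) := by
  have hac : AbsolutelyContinuousOnInterval (fun t => x t - z t) a b :=
    (hx.2.1 a (left_mem_Icc.2 hab) b (right_mem_Icc.2 hab)).fun_sub
      (hz.2.1 a (left_mem_Icc.2 hab) b (right_mem_Icc.2 hab))
  have hi1 : IntervalIntegrable (fun t => wabs s (x t - z t)) volume a b :=
    ((continuous_wabs s).comp_continuousOn hac.continuousOn).intervalIntegrable
  have hi2 : IntervalIntegrable (fun t => wabs (p ᵥ* S.B₂) (u t - v t)) volume a b := by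
    refine IntegrableOn.intervalIntegrable ?_
    rw [uIcc_of_le hab]
    exact integrableOn_wabs (hx.integrableOn_sub hz)
  have := (absolutelyContinuousOnInterval_wabs hp hac).sub_le_integral hab (hi2.sub hi1) <| by
    filter_upwards [ae_deriv_wabs_le hpos hf hp hps hab hx hz] with t ht htI
    have := (ht htI).2
    linarith
  rw [intervalIntegral.integral_sub hi2 hi1] at this
  linarith

/-- Exponential incremental stability of the Lur'e system in the weighted one-norm. -/
lemma wabs_le_exp_add_integral (hpos : S.IsPositive) (hf : S.IncrementalBound)
    {ξ : ℝ} {p : Fin n → ℝ} (hH : S.H1 ξ p) {a b : ℝ}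
    (hab : a ≤ b) {u v : ℝ → Fin m₂ → ℝ} {x z : ℝ → Fin n → ℝ}
    (hx : S.IsTrajectory (Icc a b) u x) (hz : S.IsTrajectory (Icc a b) v z) :
    wabs p (x b - z b) ≤ Real.exp (-ξ * (b - a)) * wabs p (x a - z a) +
      ∫ t in a..b, wabs (p ᵥ* S.B₂) (u t - v t) := by
  obtain ⟨hξ, hp0, hps⟩ := hH
  have hp : 0 ≤ p := fun i => (hp0 i).le
  have hr : 0 ≤ p ᵥ* S.B₂ := vecMul_nonneg hpos.2.2.1 hp
  have hac : AbsolutelyContinuousOnInterval (fun t => x t - z t) a b :=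
    (hx.2.1 a (left_mem_Icc.2 hab) b (right_mem_Icc.2 hab)).fun_sub
      (hz.2.1 a (left_mem_Icc.2 hab) b (right_mem_Icc.2 hab))
  have hi2 : IntervalIntegrable (fun t => wabs (p ᵥ* S.B₂) (u t - v t)) volume a b := by
    refine IntegrableOn.intervalIntegrable ?_
    rw [uIcc_of_le hab]
    exact integrableOn_wabs (hx.integrableOn_sub hz)
  have hE : AbsolutelyContinuousOnInterval (fun t => Real.exp (ξ * (t - b))) a b :=
    ContDiffOn.absolutelyContinuousOnInterval (ContDiff.contDiffOn (by fun_prop))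
  have := (hE.fun_smul (absolutelyContinuousOnInterval_wabs hp hac)).sub_le_integral hab hi2 <| by
    filter_upwards [ae_deriv_wabs_le hpos hf hp hps hab hx hz] with t ht htI
    obtain ⟨h1, h2⟩ := ht htI
    have hE' : HasDerivAt (fun t => Real.exp (ξ * (t - b))) (Real.exp (ξ * (t - b)) * ξ) t := by
      simpa using (((hasDerivAt_id t).sub_const b).const_mul ξ).exp
    have h3 := (hE'.fun_mul h1.hasDerivAt).deriv
    simp only [smul_eq_mul]
    rw [h3]
    rw [wabs_smul] at h2
    have h4 : 0 ≤ wabs (p ᵥ* S.B₂) (u t - v t) := wabs_nonneg hr _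
    have h5 : Real.exp (ξ * (t - b)) ≤ 1 :=
      Real.exp_le_one_iff.2 (mul_nonpos_of_nonneg_of_nonpos hξ.le (by linarith [htI.2]))
    have h6 := mul_le_mul_of_nonneg_left h2 (Real.exp_pos (ξ * (t - b))).le
    have h7 := mul_le_mul_of_nonneg_right h5 h4
    linarith
  simp only [sub_self, mul_zero, Real.exp_zero, smul_eq_mul] at this
  rw [show -ξ * (b - a) = ξ * (a - b) by ring]
  linarith

end LureSystem

/-! ### Bounds on the distance of trajectories by Stepanov norms -/

/-- A recursive estimate over intervals of length at most one propagates to a half-line, at the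
price of summing a geometric series. -/
lemma le_exp_of_unit_steps {U : ℝ → ℝ} {s ζ K : ℝ} (hζ : 0 < ζ) (hK : 0 ≤ K)
    (h : ∀ a, s ≤ a → ∀ t ∈ Icc a (a + 1), U t ≤ Real.exp (-ζ * (t - a)) * U a + K)
    {t : ℝ} (hst : s ≤ t) :
    U t ≤ Real.exp (-ζ * (t - s)) * U s + K / (1 - Real.exp (-ζ)) := by
  have hκ : Real.exp (-ζ) < 1 := by simpa using hζ
  have hκ' : 0 < 1 - Real.exp (-ζ) := by linarith
  have hκ0 := Real.exp_pos (-ζ)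
  have hKK : K ≤ K / (1 - Real.exp (-ζ)) := by
    rw [le_div_iff₀ hκ']
    nlinarith
  obtain ⟨N, hN⟩ := exists_nat_ge (t - s)
  replace hN : t ≤ s + N := by linarith
  induction N generalizing t with
  | zero =>
    obtain rfl : t = s := by simp at hN; linarith
    have : 0 ≤ K / (1 - Real.exp (-ζ)) := hK.trans hKK
    simpa using this
  | succ N ih =>
    rcases le_or_gt t (s + 1) with h1 | h1
    · linarith [h s le_rfl t ⟨hst, h1⟩]
    · have h2 := ih (t := t - 1) (by linarith) (by push_cast at hN; linarith)
      have h3 := h (t - 1) (by linarith) t ⟨by linarith, by linarith⟩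
      have h4 := mul_le_mul_of_nonneg_left h2 hκ0.le
      rw [show -ζ * (t - (t - 1)) = -ζ by ring] at h3
      rw [mul_add, ← mul_assoc, ← Real.exp_add,
        show -ζ + -ζ * (t - 1 - s) = -ζ * (t - s) by ring] at h4
      have h5 : Real.exp (-ζ) * (K / (1 - Real.exp (-ζ))) + K = K / (1 - Real.exp (-ζ)) := by
        field_simp
        ring
      linarith

section

variable {m : ℕ} {r : Fin m → ℝ} {u : ℝ → Fin m → ℝ}

lemma intervalIntegral_wabs_le (hr : 0 ≤ r) {a t : ℝ} (ht : t ∈ Icc a (a + 1))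
    (hu : IntegrableOn u (Icc a t)) {K : ℝ} (hK : 0 ≤ K)
    (h : ∫⁻ θ in Icc a (a + 1), ENNReal.ofReal (wabs r (u θ)) ≤ ENNReal.ofReal K) :
    ∫ θ in a..t, wabs r (u θ) ≤ K := by
  rw [← ENNReal.ofReal_le_ofReal_iff hK, intervalIntegral.integral_of_le ht.1,
    ofReal_integral_eq_lintegral_ofReal
      (integrableOn_wabs (hu.mono_set Ioc_subset_Icc_self))
      (Eventually.of_forall fun θ => wabs_nonneg hr _)]
  exact (lintegral_mono_set (Ioc_subset_Icc_self.trans (Icc_subset_Icc_right ht.2))).trans h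

lemma lintegral_wabs_le (hr : 0 ≤ r) (s : Set ℝ) :
    ∫⁻ θ in s, ENNReal.ofReal (wabs r (u θ)) ≤
      ENNReal.ofReal (∑ i, r i) * ∫⁻ θ in s, ‖u θ‖ₑ := by
  rw [← lintegral_const_mul' _ _ ENNReal.ofReal_ne_top]
  refine lintegral_mono fun θ => ?_
  rw [← ofReal_norm, ← ENNReal.ofReal_mul (Finset.sum_nonneg fun i _ => hr i)]
  exact ENNReal.ofReal_le_ofReal (wabs_le_norm hr _)

lemma lintegral_wabs_le_ofReal (hr : 0 ≤ r) {s : Set ℝ} {δ : ℝ}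
    (h : ∫⁻ θ in s, ‖u θ‖ₑ ≤ ENNReal.ofReal δ) :
    ∫⁻ θ in s, ENNReal.ofReal (wabs r (u θ)) ≤ ENNReal.ofReal ((∑ i, r i) * δ) := by
  rw [ENNReal.ofReal_mul (Finset.sum_nonneg fun i _ => hr i)]
  exact (lintegral_wabs_le hr s).trans (by gcongr)

end

namespace LureSystem

variable {n m₁ m₂ p₁ p₂ : ℕ} {S : LureSystem n m₁ m₂ p₁ p₂} {ξ : ℝ} {p : Fin n → ℝ}
  {u v : ℝ → Fin m₂ → ℝ} {x z : ℝ → Fin n → ℝ}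

lemma H1.nonneg (hH : S.H1 ξ p) : 0 ≤ p := fun i => (hH.2.1 i).le

lemma IsPositive.weight_nonneg (hpos : S.IsPositive) (hp : 0 ≤ p) : 0 ≤ p ᵥ* S.B₂ :=
  vecMul_nonneg hpos.2.2.1 hp

lemma wabs_le_exp_add (hpos : S.IsPositive) (hf : S.IncrementalBound) (hH : S.H1 ξ p) {s : ℝ}
    (hx : S.IsTrajectory (Ici s) u x) (hz : S.IsTrajectory (Ici s) v z) {K : ℝ} (hK : 0 ≤ K)
    (h : ∀ a, s ≤ a →
      ∫⁻ θ in Icc a (a + 1), ENNReal.ofReal (wabs (p ᵥ* S.B₂) (u θ - v θ)) ≤ ENNReal.ofReal K)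
    {t : ℝ} (hst : s ≤ t) :
    wabs p (x t - z t) ≤
      Real.exp (-ξ * (t - s)) * wabs p (x s - z s) + K / (1 - Real.exp (-ξ)) := by
  refine le_exp_of_unit_steps (U := fun t => wabs p (x t - z t)) hH.1 hK (fun a ha t ht => ?_) hst
  have hI : Icc a t ⊆ Ici s := fun θ hθ => ha.trans hθ.1
  have h1 := wabs_le_exp_add_integral hpos hf hH ht.1 (hx.mono hI) (hz.mono hI)
  have h2 := intervalIntegral_wabs_le (hpos.weight_nonneg hH.nonneg) ht
    ((hx.mono hI).integrableOn_sub (hz.mono hI)) hK (h a ha)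
  exact h1.trans (add_le_add_right h2 _)

/-- Two trajectories on `ℝ` at bounded distance have forgotten their initial values. -/
lemma wabs_le_of_bounded (hpos : S.IsPositive) (hf : S.IncrementalBound) (hH : S.H1 ξ p)
    (hx : S.IsTrajectory univ u x) (hz : S.IsTrajectory univ v z) {K : ℝ} (hK : 0 ≤ K)
    (h : ∀ a : ℝ,
      ∫⁻ θ in Icc a (a + 1), ENNReal.ofReal (wabs (p ᵥ* S.B₂) (u θ - v θ)) ≤ ENNReal.ofReal K)
    {C : ℝ} (hC : ∀ t, ‖x t - z t‖ ≤ C) (t : ℝ) :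
    wabs p (x t - z t) ≤ K / (1 - Real.exp (-ξ)) := by
  have hP : 0 ≤ ∑ i, p i := Finset.sum_nonneg fun i _ => hH.nonneg i
  have h1 : Tendsto (fun s : ℝ => Real.exp (-ξ * (t - s)) * ((∑ i, p i) * C) +
      K / (1 - Real.exp (-ξ))) atBot (𝓝 (0 * ((∑ i, p i) * C) + K / (1 - Real.exp (-ξ)))) := by
    refine (Tendsto.mul_const _ (Real.tendsto_exp_atBot.comp ?_)).add_const _
    exact (tendsto_atTop_add_const_left _ t tendsto_neg_atBot_atTop).const_mul_atTop_of_neg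
      (neg_lt_zero.2 hH.1)
  rw [zero_mul, zero_add] at h1
  refine ge_of_tendsto h1 ?_
  filter_upwards [eventually_le_atBot t] with s hs
  refine (wabs_le_exp_add hpos hf hH (hx.mono (subset_univ _)) (hz.mono (subset_univ _)) hK
    (fun a _ => h a) hs).trans ?_
  gcongr
  exact (wabs_le_norm hH.nonneg _).trans (mul_le_mul_of_nonneg_left (hC s) hP)

/-- Trajectories converge to each other if the inputs do so in the mean over unit intervals. -/
lemma tendsto_sub_of_tendsto_lintegral (hpos : S.IsPositive) (hf : S.IncrementalBound)
    (hH : S.H1 ξ p) (hx : S.IsTrajectory (Ici 0) u x) (hz : S.IsTrajectory (Ici 0) v z)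
    (h : Tendsto (fun a : ℝ => ∫⁻ θ in Icc a (a + 1), ‖u θ - v θ‖ₑ) atTop (𝓝 0)) :
    Tendsto (fun t => x t - z t) atTop (𝓝 0) := by
  obtain ⟨C, hC, hCp⟩ := exists_norm_le_wabs hH.2.1
  have hr := hpos.weight_nonneg hH.nonneg
  have hκ : 0 < 1 - Real.exp (-ξ) := by simpa using hH.1
  set R := ∑ i, (p ᵥ* S.B₂) i with hR
  have hR0 : 0 ≤ R := Finset.sum_nonneg fun i _ => hr i
  rw [Metric.tendsto_atTop]
  intro ε hε
  -- the input error is made so small that its share of the error of the state is at most `ε / 3`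
  set δ := ε / (3 * C) * (1 - Real.exp (-ξ)) / (R + 1) with hδ
  have hδ0 : 0 < δ := by positivity
  obtain ⟨s, hs⟩ := eventually_atTop.1
    (h.eventually_le_const (ENNReal.ofReal_pos.2 hδ0))
  set s' := max s 0
  have hI : Ici s' ⊆ Ici (0 : ℝ) := Ici_subset_Ici.2 (le_max_right _ _)
  have hest := fun t (ht : s' ≤ t) => wabs_le_exp_add hpos hf hH (hx.mono hI) (hz.mono hI)
    (mul_nonneg hR0 hδ0.le)
    (fun a ha => lintegral_wabs_le_ofReal hr (hs a ((le_max_left _ _).trans ha))) ht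
  have h1 : Tendsto (fun t : ℝ => Real.exp (-ξ * (t - s')) * wabs p (x s' - z s')) atTop
      (𝓝 (0 * wabs p (x s' - z s'))) := by
    refine Tendsto.mul_const _ (Real.tendsto_exp_atBot.comp ?_)
    exact (tendsto_atTop_add_const_right _ (-s') tendsto_id).const_mul_atTop_of_neg
      (neg_lt_zero.2 hH.1)
  rw [zero_mul] at h1
  obtain ⟨T, hT⟩ := eventually_atTop.1
    ((h1.eventually_le_const (show 0 < ε / (3 * C) by positivity)).and (eventually_ge_atTop s'))
  refine ⟨T, fun t ht => ?_⟩
  obtain ⟨h2, h3⟩ := hT t ht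
  have h4 : R * δ / (1 - Real.exp (-ξ)) ≤ ε / (3 * C) := by
    rw [div_le_iff₀ hκ, hδ, mul_div_assoc', div_le_iff₀ (by positivity)]
    have : 0 < ε / (3 * C) * (1 - Real.exp (-ξ)) := by positivity
    nlinarith
  rw [dist_zero_right]
  calc ‖x t - z t‖ ≤ C * wabs p (x t - z t) := hCp _
    _ ≤ C * (ε / (3 * C) + ε / (3 * C)) :=
        mul_le_mul_of_nonneg_left ((hest t h3).trans (add_le_add h2 h4)) hC.le
    _ = 2 * ε / 3 := by field_simp; norm_num
    _ < ε := by linarith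

lemma IsTrajectory.continuousOn {w : ℝ → Fin m₂ → ℝ} (hx : S.IsTrajectory (Ici 0) w x) :
    ContinuousOn x (Ici 0) := by
  intro t ht
  have h1 := (hx.2.1 0 self_mem_Ici (t + 1) (mem_Ici.2 (by linarith [mem_Ici.1 ht]))).continuousOn
  rw [uIcc_of_le (by linarith [mem_Ici.1 ht])] at h1
  refine (h1 t ⟨ht, by linarith⟩).mono_of_mem_nhdsWithin ?_
  rw [← Ici_inter_Iic]
  exact inter_mem self_mem_nhdsWithin (mem_nhdsWithin_of_mem_nhds (Iic_mem_nhds (by linarith)))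

/-- Exponentially decaying input errors cause exponentially decaying errors of the state. The rate
is taken below both the decay rate of the inputs and the rate `ξ` of incremental stability. -/
lemma exists_exp_bound (hpos : S.IsPositive) (hf : S.IncrementalBound)
    (hH : S.H1 ξ p) (hx : S.IsTrajectory (Ici 0) u x) (hz : S.IsTrajectory (Ici 0) v z)
    {α : ℝ} (hα : 0 < α) (h : ∀ᶠ a : ℝ in atTop,
      ∫⁻ θ in Icc a (a + 1), ‖Real.exp (α * θ) • (u θ - v θ)‖ₑ ≤ 1) :
    ∃ M γ : ℝ, 0 < γ ∧ ∀ t : ℝ, 0 ≤ t → ‖x t - z t‖ ≤ M * Real.exp (-γ * t) := by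
  obtain ⟨C, hC, hCp⟩ := exists_norm_le_wabs hH.2.1
  have hr := hpos.weight_nonneg hH.nonneg
  have hξ := hH.1
  set R := ∑ i, (p ᵥ* S.B₂) i with hR
  have hR0 : 0 ≤ R := Finset.sum_nonneg fun i _ => hr i
  obtain ⟨s₀, hs₀⟩ := eventually_atTop.1 h
  obtain ⟨s, hs0, hs⟩ : ∃ s : ℝ, 0 ≤ s ∧ ∀ a, s ≤ a →
      ∫⁻ θ in Icc a (a + 1), ‖Real.exp (α * θ) • (u θ - v θ)‖ₑ ≤ ENNReal.ofReal 1 :=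
    ⟨max s₀ 0, le_max_right _ _, fun a ha => by simpa using hs₀ a ((le_max_left _ _).trans ha)⟩
  set γ := min α (ξ / 2) with hγ
  have hγ0 : 0 < γ := lt_min hα (by linarith)
  have hγα : γ ≤ α := min_le_left _ _
  have hζ : 0 < ξ - γ := by linarith [min_le_right α (ξ / 2)]
  set U : ℝ → ℝ := fun t => Real.exp (γ * t) * wabs p (x t - z t) with hU
  have hstep : ∀ a, s ≤ a → ∀ t ∈ Icc a (a + 1),
      U t ≤ Real.exp (-(ξ - γ) * (t - a)) * U a + Real.exp γ * (R * 1) := by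
    intro a ha t ht
    have hI : Icc a t ⊆ Ici 0 := fun θ hθ => (hs0.trans ha).trans hθ.1
    have h1 := wabs_le_exp_add_integral hpos hf hH ht.1 (hx.mono hI) (hz.mono hI)
    have hint : IntegrableOn (fun θ => u θ - v θ) (Icc a t) :=
      (hx.mono hI).integrableOn_sub (hz.mono hI)
    have hint' : IntegrableOn (fun θ => Real.exp (α * θ) • (u θ - v θ)) (Icc a t) :=
      hint.continuousOn_smul (Continuous.continuousOn (by fun_prop)) isCompact_Icc
    have h2 := intervalIntegral_wabs_le hr ht hint' (by positivity)
      (lintegral_wabs_le_ofReal hr (hs a ha))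
    have h3 : Real.exp (γ * t) * ∫ θ in a..t, wabs (p ᵥ* S.B₂) (u θ - v θ) ≤
        Real.exp γ * ∫ θ in a..t, wabs (p ᵥ* S.B₂) (Real.exp (α * θ) • (u θ - v θ)) := by
      rw [← intervalIntegral.integral_const_mul, ← intervalIntegral.integral_const_mul]
      refine intervalIntegral.integral_mono_on ht.1
        ((IntegrableOn.intervalIntegrable (by
          rw [uIcc_of_le ht.1]; exact integrableOn_wabs hint)).const_mul _)
        ((IntegrableOn.intervalIntegrable (by
          rw [uIcc_of_le ht.1]; exact integrableOn_wabs hint')).const_mul _) fun θ hθ => ?_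
      rw [wabs_smul_right, abs_of_pos (Real.exp_pos _), ← mul_assoc, ← Real.exp_add]
      refine mul_le_mul_of_nonneg_right (Real.exp_le_exp.2 ?_) (wabs_nonneg hr _)
      have hθ0 : 0 ≤ θ := hI hθ
      nlinarith [ht.2, hθ.1]
    have h4 := mul_le_mul_of_nonneg_left h1 (Real.exp_pos (γ * t)).le
    rw [mul_add, ← mul_assoc, ← Real.exp_add] at h4
    have h5 := mul_le_mul_of_nonneg_left h2 (Real.exp_pos γ).le
    have h6 : Real.exp (-(ξ - γ) * (t - a)) * U a =
        Real.exp (γ * t + -ξ * (t - a)) * wabs p (x a - z a) := by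
      simp only [hU]
      rw [← mul_assoc, ← Real.exp_add]
      ring_nf
    rw [h6]
    linarith
  obtain ⟨B, hB⟩ := isCompact_Icc.exists_bound_of_continuousOn
    (f := fun t => x t - z t) (s := Icc 0 s)
    ((hx.continuousOn.sub hz.continuousOn).mono Icc_subset_Ici_self)
  set K := Real.exp γ * (R * 1) / (1 - Real.exp (-(ξ - γ))) with hK
  refine ⟨max (C * (U s + K)) (B * Real.exp (γ * s)), γ, hγ0, fun t ht => ?_⟩
  rw [neg_mul, Real.exp_neg, ← div_eq_mul_inv, le_div_iff₀ (Real.exp_pos _)]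
  rcases le_total t s with hts | hts
  · refine le_max_of_le_right ?_
    exact mul_le_mul (hB t ⟨ht, hts⟩) (Real.exp_le_exp.2 (by gcongr)) (Real.exp_pos _).le
      ((norm_nonneg _).trans (hB t ⟨ht, hts⟩))
  · refine le_max_of_le_left ?_
    have h1 := le_exp_of_unit_steps hζ (by positivity) hstep hts
    have h2 : Real.exp (-(ξ - γ) * (t - s)) ≤ 1 :=
      Real.exp_le_one_iff.2 (mul_nonpos_of_nonpos_of_nonneg (by linarith) (by linarith))
    have h3 : 0 ≤ U s := mul_nonneg (Real.exp_pos _).le (wabs_nonneg hH.nonneg _)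
    have h4 : U t ≤ U s + K := h1.trans (by
      gcongr
      exact mul_le_of_le_one_left h3 h2)
    calc ‖x t - z t‖ * Real.exp (γ * t) ≤ C * wabs p (x t - z t) * Real.exp (γ * t) := by
          gcongr; exact hCp _
      _ = C * U t := by simp only [hU]; ring
      _ ≤ _ := by gcongr

end LureSystem

/-! ### Common recurrence of two almost periodic functions -/

section Recurrence

variable {m n : ℕ}

/-- Two almost periodic functions on the half-line return simultaneously to their values at `t`.
If `τ k` and `σ k` are `ε`-periods of the two functions at bounded distance, then along a
subsequence the differences `τ k - σ k` are almost constant, so that `τ k - τ j` and `σ k - σ j`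
almost agree. -/
lemma IsBohrAP.exists_common_recurrence {x : ℝ → Fin n → ℝ} {z : ℝ → Fin m → ℝ}
    (hx : IsBohrAP (Ici 0) x) (hz : IsBohrAP (Ici 0) z) {t : ℝ} (ht : 0 < t) {ε : ℝ} (hε : 0 < ε)
    (N : ℝ) : ∃ T, N ≤ T ∧ ‖x (t + T) - x t‖ ≤ ε ∧ ‖z (t + T) - z t‖ ≤ ε := by
  have hε3 : 0 < ε / 3 := by positivity
  obtain ⟨l₁, hl₁, h₁⟩ := hx.2 (ε / 3) hε3
  obtain ⟨l₂, hl₂, h₂⟩ := hz.2 (ε / 3) hε3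
  choose τ hτI hτ0 hτ using fun k : ℕ => h₁ k (mem_Ici.2 k.cast_nonneg)
  choose σ hσI hσ0 hσ using fun k : ℕ => h₂ k (mem_Ici.2 k.cast_nonneg)
  have hcont : ContinuousAt z t := hz.1.continuousAt (Ici_mem_nhds ht)
  obtain ⟨η, hη, hηz⟩ := Metric.continuousAt_iff.1 hcont (ε / 3) hε3
  have hd : ∀ k, τ k - σ k ∈ Icc (-l₂) l₁ := fun k =>
    ⟨by linarith [(hτI k).1, (hσI k).2], by linarith [(hτI k).2, (hσI k).1]⟩
  obtain ⟨d, -, φ, hφ, hφd⟩ := isCompact_Icc.tendsto_subseq hd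
  obtain ⟨K, hK⟩ := Metric.cauchySeq_iff'.1 hφd.cauchySeq (min η t) (lt_min hη ht)
  set j := φ K
  obtain ⟨M, hM⟩ := exists_nat_ge (max N 0 + τ j + σ j)
  set k := φ (max M K)
  have hk : (M : ℝ) ≤ k := by
    exact_mod_cast (le_max_left M K).trans (hφ.id_le _)
  have hj := hK (max M K) (le_max_right _ _)
  simp only [Function.comp_apply, Real.dist_eq] at hj
  have hτj := mem_Ici.1 (hτ0 j)
  have hσj := mem_Ici.1 (hσ0 j)
  have hN0 := le_max_left N 0
  have hN1 := le_max_right N 0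
  have hτk := (hτI k).1
  have hσk := (hσI k).1
  refine ⟨τ k - τ j, by linarith, ?_, ?_⟩
  · have e1 := hτ j (t + (τ k - τ j)) (mem_Ici.2 (by linarith))
    have e2 := hτ k t ht.le
    rw [show t + (τ k - τ j) + τ j = t + τ k by ring] at e1
    calc ‖x (t + (τ k - τ j)) - x t‖
        = ‖(x (t + (τ k - τ j)) - x (t + τ k)) - (x t - x (t + τ k))‖ := by congr 1; abel
      _ ≤ ε / 3 + ε / 3 := (norm_sub_le _ _).trans (add_le_add e1 e2)
      _ ≤ ε := by linarith
  · set s := t + (τ k - σ k - (τ j - σ j)) with hs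
    obtain ⟨hj1, hj2⟩ := abs_lt.1 (hj.trans_le (min_le_right _ _))
    have hs0 : 0 ≤ s := by linarith
    have hsz : ‖z s - z t‖ ≤ ε / 3 := by
      rw [← dist_eq_norm]
      refine (hηz ?_).le
      rw [Real.dist_eq, hs, add_sub_cancel_left]
      exact hj.trans_le (min_le_left _ _)
    have e1 := hσ j (t + (τ k - τ j)) (mem_Ici.2 (by linarith))
    have e2 := hσ k s hs0
    rw [show t + (τ k - τ j) + σ j = s + σ k by rw [hs]; ring] at e1
    calc ‖z (t + (τ k - τ j)) - z t‖
        = ‖(z (t + (τ k - τ j)) - z (s + σ k)) - (z s - z (s + σ k)) + (z s - z t)‖ := by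
          congr 1; abel
      _ ≤ ε / 3 + ε / 3 + ε / 3 :=
          (norm_add_le _ _).trans (add_le_add ((norm_sub_le _ _).trans (add_le_add e1 e2)) hsz)
      _ = ε := by ring

/-- By common recurrence, an asymptotic bound on the distance of two almost periodic functions
holds everywhere. -/
lemma IsBohrAP.wabs_sub_le_of_eventually {x z : ℝ → Fin n → ℝ} (hx : IsBohrAP (Ici 0) x)
    (hz : IsBohrAP (Ici 0) z) {p : Fin n → ℝ} {c : ℝ}
    (h : ∀ ε > 0, ∀ᶠ s in atTop, wabs p (x s - z s) ≤ c + ε) {t : ℝ} (ht : 0 ≤ t) :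
    wabs p (x t - z t) ≤ c := by
  have hpos : ∀ t ∈ Ioi (0 : ℝ), wabs p (x t - z t) ≤ c := by
    intro t ht
    choose T hT hTx hTz using fun k : ℕ =>
      hx.exists_common_recurrence hz ht (Nat.one_div_pos_of_nat (α := ℝ) (n := k)) k
    have hT' : Tendsto (fun k => t + T k) atTop atTop :=
      tendsto_atTop_add_const_left _ _ (tendsto_atTop_mono hT tendsto_natCast_atTop_atTop)
    have hx' : Tendsto (fun k => x (t + T k)) atTop (𝓝 (x t)) :=
      tendsto_iff_norm_sub_tendsto_zero.2
        (squeeze_zero (fun _ => norm_nonneg _) hTx tendsto_one_div_add_atTop_nhds_zero_nat)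
    have hz' : Tendsto (fun k => z (t + T k)) atTop (𝓝 (z t)) :=
      tendsto_iff_norm_sub_tendsto_zero.2
        (squeeze_zero (fun _ => norm_nonneg _) hTz tendsto_one_div_add_atTop_nhds_zero_nat)
    have hw := ((continuous_wabs p).tendsto _).comp (hx'.sub hz')
    exact le_of_forall_pos_le_add fun ε hε => le_of_tendsto hw (hT'.eventually (h ε hε))
  have hcont : ContinuousOn (fun t => wabs p (x t - z t)) (Ici 0) :=
    (continuous_wabs p).comp_continuousOn (hx.1.sub hz.1)
  have hcl : t ∈ closure (Ioi (0 : ℝ)) := by rwa [closure_Ioi]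
  exact ((hcont t ht).mono Ioi_subset_Ici_self).closure_le hcl continuousWithinAt_const hpos

end Recurrence

/-! ### Stepanov almost periodic functions and their extension to the line -/

section Stepanov

variable {n : ℕ}

lemma lintegral_Icc_add_right (F : ℝ → ℝ≥0∞) (a b τ : ℝ) :
    ∫⁻ t in Icc a b, F (t + τ) = ∫⁻ t in Icc (a + τ) (b + τ), F t := by
  rw [← (measurePreserving_add_right volume τ).setLIntegral_comp_preimage_emb
    (measurableEmbedding_addRight τ) F]
  simp

lemma lintegral_Icc_le_nat_mul {F : ℝ → ℝ≥0∞} {a : ℝ} {K : ℝ≥0∞}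
    (h : ∀ c, a ≤ c → ∫⁻ t in Icc c (c + 1), F t ≤ K) (N : ℕ) :
    ∫⁻ t in Icc a (a + N), F t ≤ N * K := by
  induction N with
  | zero => simp
  | succ N ih =>
    have : Icc a (a + (N + 1 : ℕ)) ⊆ Icc a (a + N) ∪ Icc (a + N) (a + N + 1) := by
      rintro t ⟨h1, h2⟩
      push_cast at h2
      rcases le_total t (a + N) with h3 | h3
      · exact Or.inl ⟨h1, h3⟩
      · exact Or.inr ⟨h3, by linarith⟩
    calc _ ≤ _ := lintegral_mono_set this
      _ ≤ _ := lintegral_union_le _ _ _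
      _ ≤ N * K + K := add_le_add ih (h _ (by linarith [N.cast_nonneg (α := ℝ)]))
      _ = _ := by push_cast; ring

lemma lintegral_le_of_stepanovNorm_le {R : Set ℝ} {w : ℝ → Fin n → ℝ} {K : ℝ≥0∞}
    (h : stepanovNorm R w ≤ K) {a : ℝ} (ha : a ∈ R) : ∫⁻ t in Icc a (a + 1), ‖w t‖ₑ ≤ K :=
  (le_iSup₂ (f := fun a _ => ∫⁻ t in Icc a (a + 1), ‖w t‖ₑ) a ha).trans h

lemma integrableOn_comp_add_right {w : ℝ → Fin n → ℝ} (hw : LocallyIntegrableOn w (Ici 0))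
    {a b τ : ℝ} (h : 0 ≤ a + τ) : IntegrableOn (fun t => w (t + τ)) (Icc a b) := by
  have h1 : IntegrableOn w (Icc (a + τ) (b + τ)) :=
    hw.integrableOn_compact_subset (fun t ht => h.trans ht.1) isCompact_Icc
  have h2 := ((measurePreserving_add_right volume τ).integrableOn_comp_preimage
    (measurableEmbedding_addRight τ) (f := w) (s := Icc (a + τ) (b + τ))).2 h1
  simpa [Function.comp_def] using h2

lemma lintegral_le_of_mem_stepanovPeriods {w : ℝ → Fin n → ℝ} {δ τ σ a : ℝ}
    (hτ : τ ∈ stepanovPeriods (Ici 0) w δ) (h : 0 ≤ a + σ) :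
    ∫⁻ t in Icc a (a + 1), ‖w (t + σ + τ) - w (t + σ)‖ₑ ≤ ENNReal.ofReal δ := by
  rw [lintegral_Icc_add_right (fun t => ‖w (t + τ) - w t‖ₑ), add_right_comm]
  exact lintegral_le_of_stepanovNorm_le hτ.2 h

/-- Translations by two almost periods are close to each other, wherever both are defined: both are
close to the translation by the sum. -/
lemma lintegral_sub_le_of_mem_stepanovPeriods {w : ℝ → Fin n → ℝ}
    (hw : LocallyIntegrableOn w (Ici 0)) {δ ε τ σ a : ℝ}
    (hτ : τ ∈ stepanovPeriods (Ici 0) w δ) (hσ : σ ∈ stepanovPeriods (Ici 0) w ε)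
    (haτ : 0 ≤ a + τ) (haσ : 0 ≤ a + σ) :
    ∫⁻ t in Icc a (a + 1), ‖w (t + τ) - w (t + σ)‖ₑ ≤ ENNReal.ofReal δ + ENNReal.ofReal ε := by
  have h1 := lintegral_le_of_mem_stepanovPeriods hτ haσ
  have h2 := lintegral_le_of_mem_stepanovPeriods hσ haτ
  have hm : AEMeasurable (fun t => ‖w (t + σ + τ) - w (t + σ)‖ₑ)
      (volume.restrict (Icc a (a + 1))) := by
    have h3 : IntegrableOn (fun t => w (t + (σ + τ))) (Icc a (a + 1)) :=
      integrableOn_comp_add_right hw (by linarith [mem_Ici.1 hτ.1])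
    simp only [← add_assoc] at h3
    exact (h3.sub (integrableOn_comp_add_right hw haσ)).aestronglyMeasurable.enorm
  refine le_trans ?_ (add_le_add h1 h2)
  rw [← lintegral_add_left' hm]
  refine lintegral_mono fun t => ?_
  rw [add_right_comm t τ σ, ← enorm_neg (w (t + σ + τ) - w (t + τ))]
  refine le_trans (le_of_eq ?_) (enorm_add_le _ _)
  congr 1
  abel

lemma zero_mem_stepanovPeriods (w : ℝ → Fin n → ℝ) (δ : ℝ) :
    (0 : ℝ) ∈ stepanovPeriods (Ici 0) w δ :=
  ⟨self_mem_Ici, by simp [stepanovNorm]⟩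

lemma IsStepanovAP.exists_fast_periods {w : ℝ → Fin n → ℝ} (hw : IsStepanovAP (Ici 0) w) :
    ∃ τ : ℕ → ℝ, (∀ k : ℕ, (k : ℝ) ≤ τ k) ∧
      ∀ k, τ k ∈ stepanovPeriods (Ici 0) w ((1 / 2) ^ k) := by
  have : ∀ k : ℕ, ∃ τ : ℝ, (k : ℝ) ≤ τ ∧ τ ∈ stepanovPeriods (Ici 0) w ((1 / 2) ^ k) := by
    intro k
    obtain ⟨l, -, h⟩ := hw.2 ((1 / 2) ^ k) (by positivity)
    obtain ⟨τ, hτ, hτ'⟩ := h k (mem_Ici.2 k.cast_nonneg)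
    exact ⟨τ, hτ.1, hτ'⟩
  choose τ h1 h2 using this
  exact ⟨τ, h1, h2⟩

lemma tendsto_ofReal_half_pow :
    Tendsto (fun k : ℕ => ENNReal.ofReal ((1 / 2) ^ k)) atTop (𝓝 0) := by
  simpa using ENNReal.tendsto_ofReal
    (tendsto_pow_atTop_nhds_zero_of_lt_one (r := (1 / 2 : ℝ)) (by norm_num) (by norm_num))

lemma lintegral_enorm_le_liminf {μ : Measure ℝ} {f : ℝ → Fin n → ℝ} {F : ℕ → ℝ → Fin n → ℝ}
    (hm : ∀ k, AEStronglyMeasurable (F k) μ)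
    (hF : ∀ᵐ t ∂μ, Tendsto (fun k => F k t) atTop (𝓝 (f t))) :
    ∫⁻ t, ‖f t‖ₑ ∂μ ≤ liminf (fun k => ∫⁻ t, ‖F k t‖ₑ ∂μ) atTop := by
  refine le_trans (le_of_eq (lintegral_congr_ae ?_)) (lintegral_liminf_le' fun k => (hm k).enorm)
  filter_upwards [hF] with t ht using ht.enorm.liminf_eq.symm

/-- Along almost periods with summable errors the translates converge almost everywhere. -/
lemma ae_exists_tendsto_translates {w : ℝ → Fin n → ℝ} (hw : LocallyIntegrableOn w (Ici 0))
    {τ : ℕ → ℝ} (hτk : ∀ k : ℕ, (k : ℝ) ≤ τ k)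
    (hτ : ∀ k, τ k ∈ stepanovPeriods (Ici 0) w ((1 / 2) ^ k)) :
    ∀ᵐ t, ∃ l, Tendsto (fun k => w (t + τ k)) atTop (𝓝 l) := by
  have key : ∀ a : ℤ, ∀ᵐ t ∂(volume.restrict (Icc (a : ℝ) (a + 1))),
      ∃ l, Tendsto (fun k => w (t + τ k)) atTop (𝓝 l) := by
    intro a
    obtain ⟨N, hN⟩ := exists_nat_ge (-(a : ℝ))
    have hpos : ∀ k, 0 ≤ (a : ℝ) + τ (k + N) := by
      intro k
      have := hτk (k + N)
      push_cast at this
      linarith [k.cast_nonneg (α := ℝ)]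
    have h1 := Lp.ae_tendsto_of_cauchy_eLpNorm (μ := volume.restrict (Icc (a : ℝ) (a + 1)))
      (f := fun k t => w (t + τ (k + N))) (p := 1)
      (fun k => (integrableOn_comp_add_right hw (hpos k)).aestronglyMeasurable) le_rfl
      (B := fun k => ENNReal.ofReal (4 * (1 / 2) ^ k)) ?_ ?_
    · filter_upwards [h1] with t ⟨l, hl⟩
      exact ⟨l, (tendsto_add_atTop_iff_nat (f := fun k => w (t + τ k)) N).1 hl⟩
    · rw [← ENNReal.ofReal_tsum_of_nonneg (fun k => by positivity)
        (summable_geometric_two.mul_left 4)]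
      exact ENNReal.ofReal_ne_top
    · intro K i j hi hj
      rw [eLpNorm_one_eq_lintegral_enorm]
      refine (lintegral_sub_le_of_mem_stepanovPeriods hw (hτ _) (hτ _) (hpos i)
        (hpos j)).trans_lt ?_
      rw [← ENNReal.ofReal_add (by positivity) (by positivity)]
      refine (ENNReal.ofReal_lt_ofReal_iff (by positivity)).2 ?_
      have h2 : ∀ i, K ≤ i → (1 / 2 : ℝ) ^ (i + N) ≤ (1 / 2) ^ K := fun i hi =>
        pow_le_pow_of_le_one (by norm_num) (by norm_num) (by omega)
      have h3 : (0 : ℝ) < (1 / 2) ^ K := by positivity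
      linarith [h2 i hi, h2 j hj]
  have key' : ∀ᵐ t : ℝ, ∀ a : ℤ, t ∈ Icc (a : ℝ) (a + 1) →
      ∃ l, Tendsto (fun k => w (t + τ k)) atTop (𝓝 l) :=
    ae_all_iff.2 fun a => (ae_restrict_iff' measurableSet_Icc).1 (key a)
  filter_upwards [key'] with t ht
  exact ht ⌊t⌋ ⟨Int.floor_le t, (Int.lt_floor_add_one t).le⟩

lemma exists_lintegral_le_of_isStepanovAP {w : ℝ → Fin n → ℝ} (hw : IsStepanovAP univ w) :
    ∃ K : ℝ, 0 ≤ K ∧ ∀ a : ℝ, ∫⁻ t in Icc a (a + 1), ‖w t‖ₑ ≤ ENNReal.ofReal K := by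
  obtain ⟨l, hl, h⟩ := hw.2 1 one_pos
  have hint : ∀ a b, IntegrableOn w (Icc a b) := fun a b =>
    hw.1.integrableOn_compact_subset (subset_univ _) isCompact_Icc
  have hfin : ∫⁻ t in Icc 0 (l + 1), ‖w t‖ₑ ≠ ∞ := (hint 0 (l + 1)).2.ne
  refine ⟨1 + (∫⁻ t in Icc 0 (l + 1), ‖w t‖ₑ).toReal, by positivity, fun a => ?_⟩
  -- an almost period moves the interval `[a, a + 1]` into `[0, l + 1]`
  obtain ⟨τ, hτ, -, hτ'⟩ := h (-a) (mem_univ _)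
  have h1 : ∫⁻ t in Icc a (a + 1), ‖w (t + τ) - w t‖ₑ ≤ ENNReal.ofReal 1 :=
    lintegral_le_of_stepanovNorm_le hτ' (mem_univ a)
  have h2 : ∫⁻ t in Icc a (a + 1), ‖w (t + τ)‖ₑ ≤ ∫⁻ t in Icc 0 (l + 1), ‖w t‖ₑ := by
    rw [lintegral_Icc_add_right (fun t => ‖w t‖ₑ)]
    exact lintegral_mono_set (Icc_subset_Icc (by linarith [hτ.1]) (by linarith [hτ.2]))
  rw [ENNReal.ofReal_add zero_le_one ENNReal.toReal_nonneg, ENNReal.ofReal_toReal hfin]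
  refine le_trans ?_ (add_le_add h1 h2)
  have hm : AEMeasurable (fun t => ‖w (t + τ)‖ₑ) (volume.restrict (Icc a (a + 1))) := by
    have h3 := ((measurePreserving_add_right volume τ).integrableOn_comp_preimage
      (measurableEmbedding_addRight τ) (f := w) (s := Icc (a + τ) (a + 1 + τ))).2 (hint _ _)
    rw [preimage_add_const_Icc, add_sub_cancel_right, add_sub_cancel_right] at h3
    exact h3.aestronglyMeasurable.enorm
  rw [← lintegral_add_right' _ hm]
  refine lintegral_mono fun t => ?_
  rw [← enorm_neg (w (t + τ) - w t)]
  refine le_trans (le_of_eq ?_) (enorm_add_le _ _)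
  congr 1
  abel

/-- A Stepanov almost periodic function on the half-line extends to the line, and its almost periods
remain almost periods of the extension. -/
theorem IsStepanovAP.exists_extension {w : ℝ → Fin n → ℝ} (hw : IsStepanovAP (Ici 0) w) :
    ∃ we : ℝ → Fin n → ℝ, IsStepanovExtension w we ∧
      ∀ δ, stepanovPeriods (Ici 0) w δ ⊆ stepanovPeriods univ we δ := by
  obtain ⟨τ, hτk, hτ⟩ := hw.exists_fast_periods
  have hτt : Tendsto τ atTop atTop := tendsto_atTop_mono hτk tendsto_natCast_atTop_atTop
  obtain ⟨we, hwe⟩ : ∃ we : ℝ → Fin n → ℝ,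
      ∀ᵐ t, Tendsto (fun k => w (t + τ k)) atTop (𝓝 (we t)) := by
    have h := ae_exists_tendsto_translates hw.1 hτk hτ
    refine ⟨fun t => limUnder atTop fun k => w (t + τ k), ?_⟩
    filter_upwards [h] with t ht using tendsto_nhds_limUnder ht
  have hpos : ∀ a : ℝ, ∀ᶠ k in atTop, 0 ≤ a + τ k := fun a => by
    filter_upwards [hτt.eventually_ge_atTop (-a)] with k hk
    linarith
  -- by Fatou's lemma, almost periods translate `w` close to `we`
  have happrox : ∀ {δ σ a : ℝ}, σ ∈ stepanovPeriods (Ici 0) w δ → 0 ≤ a + σ →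
      ∫⁻ t in Icc a (a + 1), ‖w (t + σ) - we t‖ₑ ≤ ENNReal.ofReal δ := by
    intro δ σ a hσ ha
    obtain ⟨N, hN⟩ := eventually_atTop.1 (hpos a)
    have h1 := lintegral_enorm_le_liminf (μ := volume.restrict (Icc a (a + 1)))
      (f := fun t => w (t + σ) - we t) (F := fun k t => w (t + σ) - w (t + τ (k + N)))
      (fun k => ((integrableOn_comp_add_right hw.1 ha).sub
        (integrableOn_comp_add_right hw.1 (hN (k + N) (by omega)))).aestronglyMeasurable) ?_
    · refine h1.trans ?_
      have h2 : Tendsto (fun k => ENNReal.ofReal δ + ENNReal.ofReal ((1 / 2) ^ (k + N))) atTop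
          (𝓝 (ENNReal.ofReal δ + 0)) :=
        tendsto_const_nhds.add (tendsto_ofReal_half_pow.comp (tendsto_add_atTop_nat N))
      rw [add_zero] at h2
      rw [← h2.liminf_eq]
      exact liminf_le_liminf (Eventually.of_forall fun k =>
        lintegral_sub_le_of_mem_stepanovPeriods hw.1 hσ (hτ _) ha (hN (k + N) (by omega)))
    · filter_upwards [ae_restrict_of_ae hwe] with t ht
      exact (ht.comp (tendsto_add_atTop_nat N)).const_sub _
  have hmeas : ∀ a : ℝ, AEStronglyMeasurable we (volume.restrict (Icc a (a + 1))) := by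
    intro a
    obtain ⟨N, hN⟩ := eventually_atTop.1 (hpos a)
    refine aestronglyMeasurable_of_tendsto_ae atTop (f := fun k t => w (t + τ (k + N)))
      (fun k =>
        (integrableOn_comp_add_right hw.1 (hN (k + N) (by omega))).aestronglyMeasurable) ?_
    filter_upwards [ae_restrict_of_ae hwe] with t ht
    exact ht.comp (tendsto_add_atTop_nat N)
  have hint : ∀ a : ℝ, IntegrableOn we (Icc a (a + 1)) := by
    intro a
    obtain ⟨k, hk⟩ := (hpos a).exists
    have h1 : IntegrableOn (fun t => w (t + τ k)) (Icc a (a + 1)) :=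
      integrableOn_comp_add_right hw.1 hk
    have h2 : IntegrableOn (fun t => w (t + τ k) - we t) (Icc a (a + 1)) :=
      ⟨h1.aestronglyMeasurable.sub (hmeas a),
        (happrox (hτ k) hk).trans_lt ENNReal.ofReal_lt_top⟩
    simpa only [Pi.sub_def, sub_sub_cancel] using h1.sub h2
  have hloc : LocallyIntegrableOn we univ := fun t _ => by
    rw [nhdsWithin_univ]
    exact ⟨Icc (t - 1 / 2) (t - 1 / 2 + 1), Icc_mem_nhds (by linarith) (by linarith), hint _⟩
  have hper : ∀ δ, stepanovPeriods (Ici 0) w δ ⊆ stepanovPeriods univ we δ := by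
    intro δ σ hσ
    refine ⟨mem_univ _, iSup₂_le fun a _ => ?_⟩
    obtain ⟨N, hN⟩ := eventually_atTop.1 (hpos a)
    have hσ0 := mem_Ici.1 hσ.1
    have hwe' : ∀ᵐ t, Tendsto (fun k => w (t + σ + τ k)) atTop (𝓝 (we (t + σ))) :=
      (measurePreserving_add_right volume σ).quasiMeasurePreserving.ae hwe
    refine (lintegral_enorm_le_liminf (μ := volume.restrict (Icc a (a + 1)))
      (F := fun k t => w (t + τ (k + N) + σ) - w (t + τ (k + N))) (fun k => ?_) ?_).trans ?_
    · have h1 : IntegrableOn (fun t => w (t + (τ (k + N) + σ))) (Icc a (a + 1)) :=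
        integrableOn_comp_add_right hw.1 (by linarith [hN (k + N) (by omega)])
      simp only [← add_assoc] at h1
      exact (h1.sub (integrableOn_comp_add_right hw.1
        (hN (k + N) (by omega)))).aestronglyMeasurable
    · filter_upwards [ae_restrict_of_ae hwe, ae_restrict_of_ae hwe'] with t ht ht'
      simp only [add_right_comm t _ σ]
      exact (ht'.sub ht).comp (tendsto_add_atTop_nat N)
    · refine (liminf_le_liminf (Eventually.of_forall fun k =>
        lintegral_le_of_mem_stepanovPeriods hσ (hN (k + N) (by omega)))).trans ?_
      simp
  refine ⟨we, ⟨⟨hloc, fun ε hε => ?_⟩, ?_, ?_⟩, hper⟩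
  · obtain ⟨l, hl, h⟩ := hw.2 ε hε
    refine ⟨l, hl, fun a _ => ?_⟩
    rcases le_total 0 a with ha | ha
    · exact (h a ha).mono (inter_subset_inter_right _ (hper ε))
    rcases le_total 0 (a + l) with hal | hal
    · exact ⟨0, ⟨ha, hal⟩, hper ε (zero_mem_stepanovPeriods w ε)⟩
    · -- the set of almost periods on the line is symmetric
      obtain ⟨σ, hσ, hσ'⟩ := h (-(a + l)) (mem_Ici.2 (by linarith))
      refine ⟨-σ, ⟨by linarith [hσ.2], by linarith [hσ.1]⟩, mem_univ _, iSup₂_le fun b _ => ?_⟩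
      have h1 := lintegral_le_of_stepanovNorm_le (hper ε hσ').2 (mem_univ (b + -σ))
      rw [show b + -σ + 1 = b + 1 + -σ by ring,
        ← lintegral_Icc_add_right (fun t => ‖we (t + σ) - we t‖ₑ)] at h1
      refine le_trans (lintegral_mono fun t => ?_) h1
      rw [neg_add_cancel_right, ← enorm_neg, neg_sub]
  · -- on the half-line, `0` is an almost period for every error
    have h0 : ∀ a : ℕ, ∀ᵐ t ∂(volume.restrict (Icc (a : ℝ) (a + 1))), we t = w t := by
      intro a
      have h1 := happrox (δ := 0) (σ := 0) (a := a) (zero_mem_stepanovPeriods w 0) (by simp)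
      rw [ENNReal.ofReal_zero, nonpos_iff_eq_zero, lintegral_eq_zero_iff'] at h1
      · filter_upwards [h1] with t ht
        have h2 : w (t + 0) - we t = 0 := enorm_eq_zero.1 ht
        rw [add_zero] at h2
        exact (sub_eq_zero.1 h2).symm
      · exact ((integrableOn_comp_add_right hw.1 (by simp)).sub
          (hint a)).aestronglyMeasurable.enorm
    have h0' : ∀ᵐ t : ℝ, ∀ a : ℕ, t ∈ Icc (a : ℝ) (a + 1) → we t = w t :=
      ae_all_iff.2 fun a => (ae_restrict_iff' measurableSet_Icc).1 (h0 a)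
    refine (ae_restrict_iff' measurableSet_Ici).2 ?_
    filter_upwards [h0'] with t ht ht0
    exact ht ⌊t⌋₊ ⟨Nat.floor_le ht0, (Nat.lt_floor_add_one t).le⟩
  · intro σ hσ hσt a b
    obtain ⟨N, hN⟩ := exists_nat_ge (b - a)
    have h1 : Tendsto (fun k : ℕ => (N : ℝ≥0∞) * ENNReal.ofReal (1 / ((k : ℝ) + 1))) atTop
        (𝓝 (N * ENNReal.ofReal 0)) :=
      ENNReal.Tendsto.const_mul (ENNReal.tendsto_ofReal tendsto_one_div_add_atTop_nhds_zero_nat)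
        (Or.inr (ENNReal.natCast_ne_top N))
    rw [ENNReal.ofReal_zero, mul_zero] at h1
    refine tendsto_of_tendsto_of_tendsto_of_le_of_le' tendsto_const_nhds h1
      (Eventually.of_forall fun _ => zero_le) ?_
    filter_upwards [hσt.eventually_ge_atTop (-a)] with k hk
    refine (lintegral_mono_set (Icc_subset_Icc_right (by linarith : b ≤ a + N))).trans ?_
    exact lintegral_Icc_le_nat_mul (fun c hc => happrox (hσ k) (by linarith)) N

end Stepanov

/-! ### The bounded solution of `ẏ = -c y + g` on the line -/

section ExpConv

variable {n : ℕ} {c K : ℝ} {g g' : ℝ → Fin n → ℝ}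

/-- The function `t ↦ ∫_{-∞}^t e^{-c(t-θ)} g(θ) dθ`, the bounded solution of `ẏ = -c y + g`. -/
noncomputable def expConv (c : ℝ) (g : ℝ → Fin n → ℝ) (t : ℝ) : Fin n → ℝ :=
  ∫ θ in Iic t, Real.exp (c * (θ - t)) • g θ

lemma lintegral_exp_smul_le (hc : 0 < c) (hK : 0 ≤ K)
    (h : ∀ a : ℝ, ∫⁻ t in Icc a (a + 1), ‖g t‖ₑ ≤ ENNReal.ofReal K) (t : ℝ) :
    ∫⁻ θ in Iic t, ‖Real.exp (c * (θ - t)) • g θ‖ₑ ≤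
      ENNReal.ofReal ((1 - Real.exp (-c))⁻¹ * K) := by
  have hq : Real.exp (-c) < 1 := by simpa using hc
  have hcover : Iic t ⊆ ⋃ k : ℕ, Icc (t - k - 1) (t - k - 1 + 1) := by
    intro θ hθ
    refine mem_iUnion.2 ⟨⌊t - θ⌋₊, ?_⟩
    have h0 : 0 ≤ t - θ := sub_nonneg.2 hθ
    have h1 := Nat.floor_le h0
    have h2 := Nat.lt_floor_add_one (t - θ)
    exact ⟨by linarith, by linarith⟩
  have hpiece : ∀ k : ℕ, ∫⁻ θ in Icc (t - k - 1) (t - k - 1 + 1),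
      ‖Real.exp (c * (θ - t)) • g θ‖ₑ ≤ ENNReal.ofReal (Real.exp (-c) ^ k * K) := by
    intro k
    rw [ENNReal.ofReal_mul (by positivity)]
    refine le_trans ?_ (mul_le_mul_right (h (t - k - 1)) _)
    rw [← lintegral_const_mul' _ _ ENNReal.ofReal_ne_top]
    refine setLIntegral_mono' measurableSet_Icc fun θ hθ => ?_
    rw [enorm_smul, Real.enorm_of_nonneg (Real.exp_pos _).le, ← Real.exp_nat_mul]
    gcongr ENNReal.ofReal ?_ * _
    exact Real.exp_le_exp.2 (by nlinarith [hθ.2])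
  calc _ ≤ _ := lintegral_mono_set hcover
    _ ≤ _ := lintegral_iUnion_le _ _
    _ ≤ ∑' k : ℕ, ENNReal.ofReal (Real.exp (-c) ^ k * K) := ENNReal.tsum_le_tsum hpiece
    _ = _ := by
      rw [← ENNReal.ofReal_tsum_of_nonneg (fun k => by positivity)
        ((summable_geometric_of_lt_one (Real.exp_pos _).le hq).mul_right K), tsum_mul_right,
        tsum_geometric_of_lt_one (Real.exp_pos _).le hq]

lemma integrableOn_exp_smul (hc : 0 < c) (hK : 0 ≤ K) (hg : LocallyIntegrable g)
    (h : ∀ a : ℝ, ∫⁻ t in Icc a (a + 1), ‖g t‖ₑ ≤ ENNReal.ofReal K) (t : ℝ) :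
    IntegrableOn (fun θ => Real.exp (c * (θ - t)) • g θ) (Iic t) :=
  have hcont : Continuous fun θ => Real.exp (c * (θ - t)) := by fun_prop
  ⟨(hcont.aestronglyMeasurable.smul hg.aestronglyMeasurable).restrict,
    (lintegral_exp_smul_le hc hK h t).trans_lt ENNReal.ofReal_lt_top⟩

lemma norm_expConv_le (hc : 0 < c) (hK : 0 ≤ K)
    (h : ∀ a : ℝ, ∫⁻ t in Icc a (a + 1), ‖g t‖ₑ ≤ ENNReal.ofReal K) (t : ℝ) :
    ‖expConv c g t‖ ≤ (1 - Real.exp (-c))⁻¹ * K := by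
  have hq : 0 < 1 - Real.exp (-c) := by simpa using hc
  have h1 := (enorm_integral_le_lintegral_enorm _).trans (lintegral_exp_smul_le hc hK h t)
  rw [← ofReal_norm] at h1
  exact (ENNReal.ofReal_le_ofReal_iff (by positivity)).1 h1

lemma expConv_eq (hc : 0 < c) (hK : 0 ≤ K) (hg : LocallyIntegrable g)
    (h : ∀ a : ℝ, ∫⁻ t in Icc a (a + 1), ‖g t‖ₑ ≤ ENNReal.ofReal K) (t : ℝ) :
    expConv c g t =
      Real.exp (-c * t) • (expConv c g 0 + ∫ θ in (0 : ℝ)..t, Real.exp (c * θ) • g θ) := by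
  have hfac : ∀ s θ : ℝ, Real.exp (c * (θ - s)) • g θ =
      Real.exp (-c * s) • Real.exp (c * θ) • g θ := fun s θ => by
    rw [smul_smul, ← Real.exp_add]
    ring_nf
  have hint : ∀ s : ℝ, IntegrableOn (fun θ => Real.exp (c * θ) • g θ) (Iic s) := fun s => by
    have h1 := (integrableOn_exp_smul hc hK hg h s).smul (Real.exp (c * s))
    refine h1.congr (Eventually.of_forall fun θ => ?_)
    simp only [Pi.smul_apply, smul_smul, ← Real.exp_add]
    ring_nf
  rw [← intervalIntegral.integral_Iic_sub_Iic (hint 0) (hint t)]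
  simp only [expConv, hfac, integral_smul]
  simp

lemma locallyIntegrable_exp_smul (hg : LocallyIntegrable g) :
    LocallyIntegrable fun θ => Real.exp (c * θ) • g θ := by
  rw [← locallyIntegrableOn_univ] at *
  exact hg.continuousOn_smul isOpen_univ.isLocallyClosed (Continuous.continuousOn (by fun_prop))

lemma ae_hasDerivAt_expConv (hc : 0 < c) (hK : 0 ≤ K) (hg : LocallyIntegrable g)
    (h : ∀ a : ℝ, ∫⁻ t in Icc a (a + 1), ‖g t‖ₑ ≤ ENNReal.ofReal K) :
    ∀ᵐ t, HasDerivAt (expConv c g) (-c • expConv c g t + g t) t := by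
  filter_upwards [LocallyIntegrable.ae_hasDerivAt_integral
    (locallyIntegrable_exp_smul (c := c) hg)] with t ht
  have h1 : HasDerivAt (fun t => Real.exp (-c * t)) (Real.exp (-c * t) * -c) t := by
    simpa using ((hasDerivAt_id t).const_mul (-c)).exp
  have h2 := h1.smul ((ht 0).const_add (expConv c g 0))
  have h3 : expConv c g = fun t => Real.exp (-c * t) •
      (expConv c g 0 + ∫ θ in (0 : ℝ)..t, Real.exp (c * θ) • g θ) :=
    funext (expConv_eq hc hK hg h)
  rw [h3]
  refine h2.congr_deriv ?_
  rw [← h3, smul_smul, ← Real.exp_add, add_comm]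
  have h4 := expConv_eq hc hK hg h t
  simp only [neg_mul, neg_add_cancel, Real.exp_zero, one_smul] at *
  rw [h4]
  simp only [smul_smul, mul_comm]

lemma absolutelyContinuousOnInterval_expConv (hc : 0 < c) (hK : 0 ≤ K) (hg : LocallyIntegrable g)
    (h : ∀ a : ℝ, ∫⁻ t in Icc a (a + 1), ‖g t‖ₑ ≤ ENNReal.ofReal K) (a b : ℝ) :
    AbsolutelyContinuousOnInterval (expConv c g) a b := by
  have hli := locallyIntegrable_exp_smul (c := c) hg
  have hii : ∀ a b, IntervalIntegrable (fun θ => Real.exp (c * θ) • g θ) volume a b := fun a b =>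
    (hli.integrableOn_isCompact isCompact_uIcc).intervalIntegrable
  rw [funext (expConv_eq hc hK hg h)]
  have hE : AbsolutelyContinuousOnInterval (fun t => Real.exp (-c * t)) a b :=
    ContDiffOn.absolutelyContinuousOnInterval (ContDiff.contDiffOn (by fun_prop))
  refine hE.fun_smul (AbsolutelyContinuousOnInterval.of_eval fun i => ?_)
  have hi : IntervalIntegrable (fun θ => (Real.exp (c * θ) • g θ) i) volume a b :=
    IntegrableOn.intervalIntegrable
      (Integrable.eval (hli.integrableOn_isCompact isCompact_uIcc) i)
  have h1 := hi.absolutelyContinuousOnInterval_intervalIntegral (c := a) left_mem_uIcc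
  have h2 : AbsolutelyContinuousOnInterval (fun _ => (expConv c g 0 +
      ∫ θ in (0 : ℝ)..a, Real.exp (c * θ) • g θ) i) a b :=
    ContDiffOn.absolutelyContinuousOnInterval contDiffOn_const
  refine (funext fun t => ?_ : (fun t => (expConv c g 0 +
      ∫ θ in (0 : ℝ)..t, Real.exp (c * θ) • g θ) i) = _) ▸ h2.fun_add h1
  rw [← intervalIntegral.integral_add_adjacent_intervals (hii 0 a) (hii a t)]
  have h3 := (ContinuousLinearMap.proj (R := ℝ) (φ := fun _ : Fin n => ℝ) i)
    |>.intervalIntegral_comp_comm (hii a t)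
  simp only [ContinuousLinearMap.proj_apply] at h3
  rw [h3]
  simp [add_assoc]

lemma continuous_expConv (hc : 0 < c) (hK : 0 ≤ K) (hg : LocallyIntegrable g)
    (h : ∀ a : ℝ, ∫⁻ t in Icc a (a + 1), ‖g t‖ₑ ≤ ENNReal.ofReal K) :
    Continuous (expConv c g) := by
  refine continuous_iff_continuousAt.2 fun t => ?_
  have h1 := (absolutelyContinuousOnInterval_expConv hc hK hg h (t - 1) (t + 1)).continuousOn
  rw [uIcc_of_le (by linarith)] at h1
  exact h1.continuousAt (Icc_mem_nhds (by linarith) (by linarith))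

lemma wabs_integral_le {p : Fin n → ℝ} (hp : 0 ≤ p) {s : Set ℝ} {F : ℝ → Fin n → ℝ}
    (hF : IntegrableOn F s) : wabs p (∫ θ in s, F θ) ≤ ∫ θ in s, wabs p (F θ) := by
  have hi : ∀ i, IntegrableOn (fun θ => F θ i) s := fun i => Integrable.eval hF i
  simp only [wabs]
  rw [integral_finsetSum _ fun i _ => (hi i).abs.const_mul _]
  refine Finset.sum_le_sum fun i _ => ?_
  rw [integral_const_mul, eval_integral hi]
  exact mul_le_mul_of_nonneg_left abs_integral_le_integral_abs (hp i)

lemma wabs_expConv_sub_le (hc : 0 < c) {K' : ℝ} (hK : 0 ≤ K) (hK' : 0 ≤ K')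
    (hg : LocallyIntegrable g) (hg' : LocallyIntegrable g')
    (h : ∀ a : ℝ, ∫⁻ t in Icc a (a + 1), ‖g t‖ₑ ≤ ENNReal.ofReal K)
    (h' : ∀ a : ℝ, ∫⁻ t in Icc a (a + 1), ‖g' t‖ₑ ≤ ENNReal.ofReal K')
    {p : Fin n → ℝ} (hp : 0 ≤ p) {C : ℝ} (hC : ∀ θ, wabs p (g θ - g' θ) ≤ C) (t : ℝ) :
    wabs p (expConv c g t - expConv c g' t) ≤ C / c := by
  have hi := integrableOn_exp_smul hc hK hg h t
  have hi' := integrableOn_exp_smul hc hK' hg' h' t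
  have hexp : IntegrableOn (fun θ => Real.exp (-c * t) * Real.exp (c * θ)) (Iic t) :=
    (integrableOn_exp_mul_Iic hc t).const_mul _
  rw [expConv, expConv, ← integral_sub hi hi']
  refine (wabs_integral_le hp (hi.sub hi')).trans ?_
  calc _ ≤ ∫ θ in Iic t, (Real.exp (-c * t) * Real.exp (c * θ)) * C := by
        refine integral_mono (integrableOn_wabs (hi.sub hi')) (hexp.mul_const C)
          fun θ => ?_
        simp only [Pi.sub_apply]
        rw [← smul_sub, wabs_smul_right, abs_of_pos (Real.exp_pos _), ← Real.exp_add,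
          show -c * t + c * θ = c * (θ - t) by ring]
        exact mul_le_mul_of_nonneg_left (hC θ) (Real.exp_pos _).le
    _ = C / c := by
        rw [integral_mul_const, integral_const_mul, integral_exp_mul_Iic hc, ← mul_div_assoc,
          ← Real.exp_add]
        simp [div_eq_mul_inv, mul_comm]

end ExpConv

/-! ### The bounded trajectory on the line -/

namespace LureSystem

variable {n m₁ m₂ p₁ p₂ : ℕ} {S : LureSystem n m₁ m₂ p₁ p₂}

lemma IncrementalBound.continuous (hf : S.IncrementalBound) : Continuous S.f := by
  refine continuous_pi fun i => continuous_iff_continuousAt.2 fun ζ => ?_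
  have h1 : Continuous fun ζ' : Fin p₁ → ℝ => ∑ j, S.Δ i j * |ζ' j - ζ j| := by fun_prop
  have h2 := h1.tendsto ζ
  simp only [sub_self, abs_zero, mul_zero, Finset.sum_const_zero] at h2
  exact tendsto_iff_dist_tendsto_zero.2
    (squeeze_zero (fun _ => dist_nonneg) (fun ζ' => hf.2 ζ' ζ i) h2)

lemma IncrementalBound.continuous_field (hf : S.IncrementalBound) (u : Fin m₂ → ℝ) :
    Continuous fun x => S.field x u := by
  have h1 : Continuous fun x : Fin n → ℝ => S.A *ᵥ x := Continuous.matrix_mulVec continuous_const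
    continuous_id
  have h2 : Continuous fun x : Fin n → ℝ => S.f (S.C₁ *ᵥ x) :=
    hf.continuous.comp (Continuous.matrix_mulVec continuous_const continuous_id)
  exact (h1.add (Continuous.matrix_mulVec continuous_const h2)).add continuous_const

/-- A bounded continuous state and a uniformly locally integrable input yield a uniformly locally
integrable right-hand side. -/
lemma exists_lintegral_field_le (hf : S.IncrementalBound) (c : ℝ) {w : ℝ → Fin m₂ → ℝ}
    (hw : LocallyIntegrable w) {K : ℝ} (hK : 0 ≤ K)
    (hwK : ∀ a : ℝ, ∫⁻ t in Icc a (a + 1), ‖w t‖ₑ ≤ ENNReal.ofReal K)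
    (y : BoundedContinuousFunction ℝ (Fin n → ℝ)) :
    LocallyIntegrable (fun t => c • y t + S.field (y t) (w t)) ∧
      ∃ K', 0 ≤ K' ∧ ∀ a : ℝ,
        ∫⁻ t in Icc a (a + 1), ‖c • y t + S.field (y t) (w t)‖ₑ ≤ ENNReal.ofReal K' := by
  set F : (Fin n → ℝ) → Fin n → ℝ := fun x => c • x + S.field x 0 with hF
  have hFc : Continuous F := (continuous_const_smul c).add (hf.continuous_field 0)
  set L : (Fin m₂ → ℝ) →L[ℝ] (Fin n → ℝ) := S.B₂.mulVecLin.toContinuousLinearMap with hL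
  have hsplit : ∀ t, c • y t + S.field (y t) (w t) = F (y t) + L (w t) := by
    intro t
    simp [hF, hL, field, add_assoc]
  simp only [hsplit]
  have hLw : LocallyIntegrable fun t => L (w t) := by
    rw [← locallyIntegrableOn_univ] at *
    exact L.locallyIntegrableOn_comp hw
  have hFy : Continuous fun t => F (y t) := hFc.comp y.continuous
  refine ⟨hFy.locallyIntegrable.add hLw, ?_⟩
  obtain ⟨M, hM⟩ := (isCompact_closedBall (0 : Fin n → ℝ) ‖y‖).exists_bound_of_continuousOn
    hFc.continuousOn
  have hM' : ∀ t, ‖F (y t)‖ ≤ M := fun t => hM _ (by simpa using y.norm_coe_le_norm t)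
  have hM0 : 0 ≤ M := (norm_nonneg _).trans (hM' 0)
  refine ⟨M + ‖L‖ * K, by positivity, fun a => ?_⟩
  rw [ENNReal.ofReal_add hM0 (by positivity), ENNReal.ofReal_mul (norm_nonneg _)]
  have h1 : ∫⁻ t in Icc a (a + 1), ‖F (y t)‖ₑ ≤ ENNReal.ofReal M := by
    refine (setLIntegral_mono' (g := fun _ => ENNReal.ofReal M) measurableSet_Icc
      fun t _ => ?_).trans (by simp)
    rw [← ofReal_norm]
    exact ENNReal.ofReal_le_ofReal (hM' t)
  have h2 : ∫⁻ t in Icc a (a + 1), ‖L (w t)‖ₑ ≤ ENNReal.ofReal ‖L‖ * ENNReal.ofReal K := by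
    refine le_trans ?_ (mul_le_mul_right (hwK a) _)
    rw [← lintegral_const_mul' _ _ ENNReal.ofReal_ne_top]
    refine lintegral_mono fun t => ?_
    rw [← ofReal_norm, ← ofReal_norm, ← ENNReal.ofReal_mul (norm_nonneg _)]
    exact ENNReal.ofReal_le_ofReal (L.le_opNorm _)
  refine le_trans ?_ (add_le_add h1 h2)
  rw [← lintegral_add_left' hFy.aestronglyMeasurable.enorm]
  exact lintegral_mono fun t => enorm_add_le _ _

/-- The bounded trajectory on the line. For `c` so large that `A + c I` is nonnegative, the bounded
solutions of `ẏ = field y w` are the fixed points of `y ↦ expConv c (c y + field y w)`, which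
contracts the supremum of the weighted one-norm `wabs p` with the constant `(c - ξ) / c`. -/
theorem exists_bounded_trajectory (hpos : S.IsPositive) (hf : S.IncrementalBound)
    {ξ : ℝ} {p : Fin n → ℝ} (hH : S.H1 ξ p) {w : ℝ → Fin m₂ → ℝ} (hw : IsStepanovAP univ w) :
    ∃ y : ℝ → Fin n → ℝ, S.IsTrajectory univ w y ∧ ∃ M : ℝ, ∀ t, ‖y t‖ ≤ M := by
  obtain ⟨K, hK, hwK⟩ := exists_lintegral_le_of_isStepanovAP hw
  have hwl : LocallyIntegrable w := locallyIntegrableOn_univ.1 hw.1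
  obtain ⟨c₀, hc₀⟩ := S.exists_shift
  have hξ := hH.1
  set c := max c₀ ξ with hc
  have hcξ : ξ ≤ c := le_max_right _ _
  have hc0 : 0 < c := hξ.trans_le hcξ
  have hcA : ∀ i, 0 ≤ c + S.A i i := fun i =>
    (hc₀ i).trans (add_le_add_left (le_max_left _ _) _)
  set g : BoundedContinuousFunction ℝ (Fin n → ℝ) → ℝ → Fin n → ℝ :=
    fun y t => c • y t + S.field (y t) (w t) with hg
  have hgl : ∀ y, LocallyIntegrable (g y) := fun y =>
    (exists_lintegral_field_le hf c hwl hK hwK y).1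
  choose K' hK' hgK using fun y => (exists_lintegral_field_le hf c hwl hK hwK y).2
  set T : BoundedContinuousFunction ℝ (Fin n → ℝ) → BoundedContinuousFunction ℝ (Fin n → ℝ) :=
    fun y => BoundedContinuousFunction.ofNormedAddCommGroup (expConv c (g y))
      (continuous_expConv hc0 (hK' y) (hgl y) (hgK y)) _
      (norm_expConv_le hc0 (hK' y) (hgK y)) with hT
  set κ := (c - ξ) / c with hκ
  have hκ0 : 0 ≤ κ := div_nonneg (by linarith) hc0.le
  have hκ1 : κ < 1 := (div_lt_one hc0).2 (by linarith)
  have hstep : ∀ (y y' : BoundedContinuousFunction ℝ (Fin n → ℝ)) (C : ℝ),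
      (∀ t, wabs p (y t - y' t) ≤ C) → ∀ t, wabs p (T y t - T y' t) ≤ κ * C := by
    intro y y' C hC t
    have h1 : ∀ θ, wabs p (g y θ - g y' θ) ≤ (c - ξ) * C := by
      intro θ
      have h2 := wabs_field_sub_le hpos hf hH.nonneg hH.2.2 hcA (y θ) (y' θ) (w θ) (w θ)
      rw [sub_self, wabs_zero, wabs_smul] at h2
      have h3 : g y θ - g y' θ = c • (y θ - y' θ) +
          (S.field (y θ) (w θ) - S.field (y' θ) (w θ)) := by
        simp only [hg, smul_sub]
        abel
      rw [h3]
      have h4 := mul_le_mul_of_nonneg_left (hC θ) (sub_nonneg.2 hcξ)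
      linarith
    have h5 := wabs_expConv_sub_le hc0 (hK' y) (hK' y') (hgl y) (hgl y') (hgK y) (hgK y')
      hH.nonneg h1 t
    rwa [mul_div_right_comm] at h5
  have hiter : ∀ (N : ℕ) (y y' : BoundedContinuousFunction ℝ (Fin n → ℝ)) (C : ℝ),
      (∀ t, wabs p (y t - y' t) ≤ C) → ∀ t, wabs p (T^[N] y t - T^[N] y' t) ≤ κ ^ N * C := by
    intro N
    induction N with
    | zero => intro y y' C hC t; simpa using hC t
    | succ N ih =>
      intro y y' C hC t
      rw [Function.iterate_succ_apply', Function.iterate_succ_apply', pow_succ', mul_assoc]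
      exact hstep _ _ _ (ih y y' C hC) t
  -- in the sup norm only some iterate of the map contracts
  obtain ⟨C₀, hC₀, hC₀p⟩ := exists_norm_le_wabs hH.2.1
  have hP : 0 ≤ ∑ i, p i := Finset.sum_nonneg fun i _ => hH.nonneg i
  obtain ⟨N, hN⟩ := exists_pow_lt_of_lt_one
    (show 0 < 1 / (2 * (C₀ * (∑ i, p i + 1))) by positivity) hκ1
  have hcontr : ContractingWith (1 / 2) T^[N] := by
    refine ⟨by norm_num, LipschitzWith.of_dist_le_mul fun y y' => ?_⟩
    rw [BoundedContinuousFunction.dist_le (by positivity)]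
    intro t
    have h1 : ∀ t, wabs p (y t - y' t) ≤ (∑ i, p i) * dist y y' := fun t =>
      (wabs_le_norm hH.nonneg _).trans (mul_le_mul_of_nonneg_left
        (by rw [← dist_eq_norm]; exact BoundedContinuousFunction.dist_coe_le_dist t) hP)
    rw [dist_eq_norm]
    calc ‖T^[N] y t - T^[N] y' t‖ ≤ C₀ * (κ ^ N * ((∑ i, p i) * dist y y')) :=
          (hC₀p _).trans (mul_le_mul_of_nonneg_left (hiter N y y' _ h1 t) hC₀.le)
      _ ≤ C₀ * (1 / (2 * (C₀ * (∑ i, p i + 1))) * ((∑ i, p i + 1) * dist y y')) := by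
          gcongr
          linarith
      _ = ((1 / 2 : NNReal) : ℝ) * dist y y' := by
          push_cast
          field_simp
  have hfix := hcontr.isFixedPt_fixedPoint_iterate
  set y := ContractingWith.fixedPoint T^[N] hcontr
  have hy : (y : ℝ → Fin n → ℝ) = expConv c (g y) := by
    conv_lhs => rw [← hfix.eq]
    rfl
  refine ⟨y, ⟨hw.1, fun a _ b _ => ?_, ?_⟩, ‖y‖, y.norm_coe_le_norm⟩
  · rw [hy]
    exact absolutelyContinuousOnInterval_expConv hc0 (hK' y) (hgl y) (hgK y) a b
  · rw [Measure.restrict_univ]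
    filter_upwards [ae_hasDerivAt_expConv hc0 (hK' y) (hgl y) (hgK y)] with t ht
    rw [← hy] at ht
    refine ht.congr_deriv ?_
    change -c • y t + (c • y t + S.field (y t) (w t)) = S.field (y t) (w t)
    simp

lemma IsTrajectory.comp_add_right {w : ℝ → Fin m₂ → ℝ} {x : ℝ → Fin n → ℝ}
    (h : S.IsTrajectory univ w x) (τ : ℝ) :
    S.IsTrajectory univ (fun t => w (t + τ)) (fun t => x (t + τ)) := by
  refine ⟨?_, fun a _ b _ => (h.2.1 _ (mem_univ _) _ (mem_univ _)).comp_add_right, ?_⟩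
  · have h1 := locallyIntegrableOn_univ.1 h.1
    rw [locallyIntegrableOn_univ]
    rw [← (measurePreserving_add_right volume τ).map_eq] at h1
    exact (locallyIntegrable_map_homeomorph (Homeomorph.addRight τ)).1 h1
  · have h2 := h.2.2
    rw [Measure.restrict_univ] at *
    filter_upwards [(measurePreserving_add_right volume τ).quasiMeasurePreserving.ae h2] with t ht
    exact ht.comp_add_const t τ

/-- Almost periods of the input are almost periods of the bounded trajectory, with an error that
depends linearly on that of the input. -/
lemma exists_norm_translate_sub_le (hpos : S.IsPositive) (hf : S.IncrementalBound)
    {ξ : ℝ} {p : Fin n → ℝ} (hH : S.H1 ξ p) : ∃ C : ℝ, 0 < C ∧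
      ∀ (w : ℝ → Fin m₂ → ℝ) (z : ℝ → Fin n → ℝ), S.IsTrajectory univ w z →
        (∃ M, ∀ t, ‖z t‖ ≤ M) → ∀ δ, 0 ≤ δ → ∀ τ ∈ stepanovPeriods univ w δ,
          ∀ t, ‖z (t + τ) - z t‖ ≤ C * δ := by
  obtain ⟨C₀, hC₀, hC₀p⟩ := exists_norm_le_wabs hH.2.1
  have hr := hpos.weight_nonneg hH.nonneg
  have hR0 : 0 ≤ ∑ i, (p ᵥ* S.B₂) i := Finset.sum_nonneg fun i _ => hr i
  have hκ : 0 < 1 - Real.exp (-ξ) := by simpa using hH.1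
  refine ⟨C₀ * ((∑ i, (p ᵥ* S.B₂) i + 1) / (1 - Real.exp (-ξ))), by positivity,
    fun w z hz ⟨M, hM⟩ δ hδ τ hτ t => ?_⟩
  have h1 := wabs_le_of_bounded hpos hf hH (hz.comp_add_right τ) hz (mul_nonneg hR0 hδ)
    (fun a => lintegral_wabs_le_ofReal hr (lintegral_le_of_stepanovNorm_le hτ.2 (mem_univ a)))
    (C := M + M) (fun t => (norm_sub_le _ _).trans (add_le_add (hM _) (hM _))) t
  calc ‖z (t + τ) - z t‖ ≤ C₀ * ((∑ i, (p ᵥ* S.B₂) i) * δ / (1 - Real.exp (-ξ))) :=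
        (hC₀p _).trans (mul_le_mul_of_nonneg_left h1 hC₀.le)
    _ ≤ C₀ * ((∑ i, (p ᵥ* S.B₂) i + 1) * δ / (1 - Real.exp (-ξ))) := by
        gcongr
        linarith
    _ = _ := by ring

end LureSystem

/-! ### Inputs that converge to each other in the mean over unit intervals -/

section Convergence

variable {m : ℕ} {u v w : ℝ → Fin m → ℝ}

lemma lintegral_le_stepanovNorm_translate (F : ℝ → Fin m → ℝ) (t : ℝ) :
    ∫⁻ θ in Icc t (t + 1), ‖F θ‖ₑ ≤ stepanovNorm (Ici 0) fun θ => F (θ + t) := by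
  refine le_trans (le_of_eq ?_) (lintegral_le_of_stepanovNorm_le le_rfl self_mem_Ici)
  rw [lintegral_Icc_add_right (fun θ => ‖F θ‖ₑ), zero_add, zero_add, add_comm 1 t]

lemma IsULocVanishing.tendsto_lintegral {α : ℝ} (h : IsULocVanishing α u) :
    Tendsto (fun t : ℝ => ∫⁻ θ in Icc t (t + 1), ‖Real.exp (α * θ) • u θ‖ₑ) atTop (𝓝 0) :=
  tendsto_of_tendsto_of_tendsto_of_le_of_le tendsto_const_nhds h.2.2 (fun _ => zero_le)
    fun t => lintegral_le_stepanovNorm_translate (fun θ => Real.exp (α * θ) • u θ) t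

lemma lintegral_Icc_unit_le {F : ℝ → ℝ≥0∞} {a : ℝ} {K : ℝ≥0∞}
    (h : ∀ θ ∈ Icc a (a + 1), F θ ≤ K) : ∫⁻ θ in Icc a (a + 1), F θ ≤ K :=
  (setLIntegral_mono' (g := fun _ => K) measurableSet_Icc h).trans (by simp)

lemma isULocVanishing_zero_of_tendsto (hc : ContinuousOn u (Ici 0))
    (h : Tendsto u atTop (𝓝 0)) : IsULocVanishing 0 u := by
  have he : Tendsto (fun θ => ‖u θ‖ₑ) atTop (𝓝 0) := by simpa using h.enorm
  refine ⟨hc.locallyIntegrableOn measurableSet_Ici, ?_, ?_⟩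
  · obtain ⟨T, hT⟩ := eventually_atTop.1 (ENNReal.tendsto_nhds_zero.1 he 1 one_pos)
    obtain ⟨M, hM⟩ := isCompact_Icc.exists_bound_of_continuousOn
      (hc.mono (Icc_subset_Ici_self : Icc 0 T ⊆ Ici 0))
    refine (iSup₂_le fun a ha => lintegral_Icc_unit_le (K := max (ENNReal.ofReal M) 1)
      fun θ hθ => ?_).trans_lt (max_lt ENNReal.ofReal_lt_top ENNReal.one_lt_top)
    rcases le_total θ T with h1 | h1
    · refine le_max_of_le_left ?_
      rw [← ofReal_norm]
      exact ENNReal.ofReal_le_ofReal (hM θ ⟨(mem_Ici.1 ha).trans hθ.1, h1⟩)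
    · exact le_max_of_le_right (hT θ h1)
  · simp only [zero_mul, Real.exp_zero, one_smul]
    refine ENNReal.tendsto_nhds_zero.2 fun ε hε => ?_
    obtain ⟨T, hT⟩ := eventually_atTop.1 (ENNReal.tendsto_nhds_zero.1 he ε hε)
    filter_upwards [eventually_ge_atTop T] with t ht
    exact iSup₂_le fun a ha => lintegral_Icc_unit_le fun θ hθ =>
      hT _ (by linarith [mem_Ici.1 ha, hθ.1])

lemma tendsto_lintegral_of_tendsto_eLpNorm_top
    (h : Tendsto (fun t : ℝ => eLpNorm u ∞ (volume.restrict (Ioi t))) atTop (𝓝 0)) :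
    Tendsto (fun t : ℝ => ∫⁻ θ in Icc t (t + 1), ‖u θ‖ₑ) atTop (𝓝 0) := by
  refine tendsto_of_tendsto_of_tendsto_of_le_of_le tendsto_const_nhds h (fun _ => zero_le)
    fun t => ?_
  have h1 : ∀ᵐ θ ∂(volume.restrict (Ioc t (t + 1))),
      ‖u θ‖ₑ ≤ eLpNorm u ∞ (volume.restrict (Ioi t)) := by
    rw [eLpNorm_exponent_top]
    exact ae_mono (Measure.restrict_mono_set _ Ioc_subset_Ioi_self) (ae_le_eLpNormEssSup)
  rw [setLIntegral_congr Ioc_ae_eq_Icc.symm]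
  exact (lintegral_mono_ae h1).trans (by simp)

lemma tendsto_lintegral_of_integrableOn (h : IntegrableOn u (Ici 0)) :
    Tendsto (fun t : ℝ => ∫⁻ θ in Icc t (t + 1), ‖u θ‖ₑ) atTop (𝓝 0) := by
  have h1 : Tendsto (fun t : ℝ => ∫⁻ θ in Ici (0 : ℝ),
      (Icc t (t + 1)).indicator (fun θ => ‖u θ‖ₑ) θ) atTop
      (𝓝 (∫⁻ _ in Ici (0 : ℝ), 0)) := by
    refine tendsto_lintegral_filter_of_dominated_convergence' (fun θ => ‖u θ‖ₑ)
      (Eventually.of_forall fun t => h.aestronglyMeasurable.enorm.indicator measurableSet_Icc)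
      (Eventually.of_forall fun t => Eventually.of_forall fun θ =>
        indicator_le_self' (fun _ _ => zero_le) θ) h.2.ne
      (Eventually.of_forall fun θ => ?_)
    refine tendsto_const_nhds.congr' ?_
    filter_upwards [eventually_gt_atTop θ] with t ht
    rw [indicator_of_notMem fun hθ => ht.not_ge hθ.1]
  rw [lintegral_zero] at h1
  refine h1.congr' ?_
  filter_upwards [eventually_ge_atTop 0] with t ht
  rw [lintegral_indicator measurableSet_Icc, Measure.restrict_restrict measurableSet_Icc,
    inter_eq_left.2 (show Icc t (t + 1) ⊆ Ici 0 from fun θ hθ => ht.trans hθ.1)]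

end Convergence

/-! ### Almost periodic trajectories on the half-line -/

namespace LureSystem

variable {n m₁ m₂ p₁ p₂ : ℕ} {S : LureSystem n m₁ m₂ p₁ p₂} {ξ : ℝ} {p : Fin n → ℝ}
  {v w : ℝ → Fin m₂ → ℝ} {x z : ℝ → Fin n → ℝ}

/-- For almost periodic trajectories the transient term in the incremental stability estimate
disappears, because almost periodic functions recur. -/
lemma wabs_sub_le_of_isBohrAP (hpos : S.IsPositive) (hf : S.IncrementalBound) (hH : S.H1 ξ p)
    (hx : IsBohrAP (Ici 0) x) (hz : IsBohrAP (Ici 0) z)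
    (htx : S.IsTrajectory (Ici 0) v x) (htz : S.IsTrajectory (Ici 0) w z) {K : ℝ} (hK : 0 ≤ K)
    (h : ∀ a : ℝ, 0 ≤ a →
      ∫⁻ θ in Icc a (a + 1), ENNReal.ofReal (wabs (p ᵥ* S.B₂) (v θ - w θ)) ≤ ENNReal.ofReal K)
    {t : ℝ} (ht : 0 ≤ t) : wabs p (x t - z t) ≤ K / (1 - Real.exp (-ξ)) := by
  refine hx.wabs_sub_le_of_eventually hz (fun ε hε => ?_) ht
  have h1 : Tendsto (fun t : ℝ => Real.exp (-ξ * (t - 0)) * wabs p (x 0 - z 0)) atTop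
      (𝓝 (0 * wabs p (x 0 - z 0))) := by
    refine Tendsto.mul_const _ (Real.tendsto_exp_atBot.comp ?_)
    simpa using tendsto_id.const_mul_atTop_of_neg (neg_lt_zero.2 hH.1)
  rw [zero_mul] at h1
  filter_upwards [h1.eventually_le_const hε, eventually_ge_atTop 0] with s hs hs0
  linarith [wabs_le_exp_add hpos hf hH htx htz hK h hs0]

lemma _root_.lintegral_le_of_stepanovNormW_ne_top {m : ℕ} {r s : Fin m → ℝ} (hsr : s ≤ r)
    {u : ℝ → Fin m → ℝ} (h : stepanovNormW r u ≠ ∞) {a : ℝ} (ha : 0 ≤ a) :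
    ∫⁻ θ in Icc a (a + 1), ENNReal.ofReal (wabs s (u θ)) ≤
      ENNReal.ofReal (stepanovNormW r u).toReal := by
  rw [ENNReal.ofReal_toReal h]
  refine (lintegral_mono fun θ => ENNReal.ofReal_le_ofReal (wabs_mono hsr _)).trans ?_
  exact le_iSup₂ (f := fun a _ => ∫⁻ θ in Icc a (a + 1), ENNReal.ofReal (wabs r (u θ))) a ha

lemma _root_.stepanovNormW_le_linftyNormW {m : ℕ} {r s : Fin m → ℝ} (hsr : s ≤ r)
    (u : ℝ → Fin m → ℝ) : stepanovNormW s u ≤ linftyNormW r u := by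
  refine iSup₂_le fun a ha => ?_
  have h1 : ∀ᵐ θ ∂(volume.restrict (Icc a (a + 1))),
      ENNReal.ofReal (wabs s (u θ)) ≤ linftyNormW r u := by
    refine ae_mono (Measure.restrict_mono_set _ fun θ hθ => (mem_Ici.1 ha).trans hθ.1) ?_
    filter_upwards [ENNReal.ae_le_essSup fun θ => ENNReal.ofReal (wabs r (u θ))] with θ hθ
    exact (ENNReal.ofReal_le_ofReal (wabs_mono hsr _)).trans hθ
  exact (lintegral_mono_ae h1).trans (by simp)

/-- The incremental gain of almost periodic trajectories, from the Stepanov norm of the input to the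
supremum norm of the state. -/
lemma linftyNormW_sub_le (hpos : S.IsPositive) (hf : S.IncrementalBound) (hH : S.H1 ξ p)
    (hx : IsBohrAP (Ici 0) x) (hz : IsBohrAP (Ici 0) z)
    (htx : S.IsTrajectory (Ici 0) v x) (htz : S.IsTrajectory (Ici 0) w z) :
    linftyNormW p (fun t => x t - z t) ≤ ENNReal.ofReal (1 - Real.exp (-ξ))⁻¹ *
      stepanovNormW (p ᵥ* S.B₂) (fun t => v t - w t) := by
  have hκ : 0 < 1 - Real.exp (-ξ) := by simpa using hH.1
  by_cases htop : stepanovNormW (p ᵥ* S.B₂) (fun t => v t - w t) = ∞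
  · rw [htop, ENNReal.mul_top (by simpa using hH.1)]
    exact le_top
  · refine essSup_le_of_ae_le _ ((ae_restrict_iff' measurableSet_Ici).2
      (Eventually.of_forall fun t ht => ?_))
    refine (ENNReal.ofReal_le_ofReal (wabs_sub_le_of_isBohrAP hpos hf hH hx hz htx htz
      ENNReal.toReal_nonneg
      (fun a ha => lintegral_le_of_stepanovNormW_ne_top le_rfl htop ha) ht)).trans ?_
    rw [div_eq_inv_mul, ENNReal.ofReal_mul (by positivity), ENNReal.ofReal_toReal htop]

lemma H2.h1 (hpos : S.IsPositive) {l : Fin n → ℝ} {q : Fin p₂ → ℝ} {r k : Fin m₂ → ℝ}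
    (h : S.H2 ξ p l q r k) : S.H1 ξ p := by
  obtain ⟨hξ, hp, hl, hq, -, -, h1, -⟩ := h
  refine ⟨hξ, hp, fun i => ?_⟩
  have h2 := congrFun h1 i
  have h3 := vecMul_nonneg hpos.2.2.2.2 hq i
  have h4 := hl i
  simp only [Pi.add_apply, Pi.zero_apply, Pi.neg_apply] at *
  linarith

/-- The incremental gain from the input to the output `C₂ x`: the output is paid for by the
dissipation of the storage function `wabs p`, whose values the state estimate bounds. -/
lemma stepanovNormW_output_sub_le (hpos : S.IsPositive) (hf : S.IncrementalBound)
    {l : Fin n → ℝ} {q : Fin p₂ → ℝ} {r k : Fin m₂ → ℝ} (hH2 : S.H2 ξ p l q r k)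
    (hx : IsBohrAP (Ici 0) x) (hz : IsBohrAP (Ici 0) z)
    (htx : S.IsTrajectory (Ici 0) v x) (htz : S.IsTrajectory (Ici 0) w z) :
    stepanovNormW q (fun t => S.C₂ *ᵥ x t - S.C₂ *ᵥ z t) ≤
      ENNReal.ofReal ((1 - Real.exp (-ξ))⁻¹ + 1) * stepanovNormW r (fun t => v t - w t) := by
  have hH := hH2.h1 hpos
  obtain ⟨hξ, hp0, hl, hq, -, hk, h1, h2⟩ := hH2
  have hp := hH.nonneg
  have hκ : 0 < 1 - Real.exp (-ξ) := by simpa using hξ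
  have hqC : 0 ≤ q ᵥ* S.C₂ := vecMul_nonneg hpos.2.2.2.2 hq
  have hpr : p ᵥ* S.B₂ ≤ r := fun i => by
    have h3 := congrFun h2 i
    have h4 := hk i
    simp only [Pi.add_apply, Pi.sub_apply, Pi.zero_apply] at *
    linarith
  have hps : p ᵥ* (S.A + S.B₁ * S.Δ * S.C₁) ≤ -(q ᵥ* S.C₂) := fun i => by
    have h3 := congrFun h1 i
    have h4 := hl i
    have h5 := mul_nonneg hξ.le (hp i)
    simp only [Pi.add_apply, Pi.zero_apply, Pi.neg_apply, Pi.smul_apply, smul_eq_mul] at *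
    linarith
  by_cases htop : stepanovNormW r (fun t => v t - w t) = ∞
  · rw [htop, ENNReal.mul_top (by simp; positivity)]
    exact le_top
  set K := (stepanovNormW r (fun t => v t - w t)).toReal with hK
  have hK0 : 0 ≤ K := ENNReal.toReal_nonneg
  have hKa := fun a (ha : 0 ≤ a) => lintegral_le_of_stepanovNormW_ne_top hpr htop ha
  refine iSup₂_le fun a ha => ?_
  have ha' : a ≤ a + 1 := by linarith
  have hI : Icc a (a + 1) ⊆ Ici 0 := fun θ hθ => (mem_Ici.1 ha).trans hθ.1
  have hV := wabs_sub_le_of_isBohrAP hpos hf hH hx hz htx htz hK0 hKa ha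
  have hdis := wabs_add_integral_le hpos hf hp hps ha' (htx.mono hI) (htz.mono hI)
  have hin := intervalIntegral_wabs_le (hpos.weight_nonneg hp) (right_mem_Icc.2 ha')
    ((htx.mono hI).integrableOn_sub (htz.mono hI)) hK0 (hKa a ha)
  have hV1 := wabs_nonneg hp (x (a + 1) - z (a + 1))
  have hint : IntegrableOn (fun t => x t - z t) (Icc a (a + 1)) :=
    ((hx.1.sub hz.1).mono hI).integrableOn_Icc
  calc ∫⁻ t in Icc a (a + 1), ENNReal.ofReal (wabs q (S.C₂ *ᵥ x t - S.C₂ *ᵥ z t))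
      ≤ ∫⁻ t in Icc a (a + 1), ENNReal.ofReal (wabs (q ᵥ* S.C₂) (x t - z t)) := by
        refine lintegral_mono fun t => ENNReal.ofReal_le_ofReal ?_
        rw [← mulVec_sub]
        exact wabs_mulVec_le hpos.2.2.2.2 hq _
    _ = ENNReal.ofReal (∫ t in a..(a + 1), wabs (q ᵥ* S.C₂) (x t - z t)) := by
        rw [intervalIntegral.integral_of_le ha', ← integral_Icc_eq_integral_Ioc]
        exact (ofReal_integral_eq_lintegral_ofReal (integrableOn_wabs hint)
          (Eventually.of_forall fun θ => wabs_nonneg hqC _)).symm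
    _ ≤ ENNReal.ofReal (((1 - Real.exp (-ξ))⁻¹ + 1) * K) := by
        refine ENNReal.ofReal_le_ofReal ?_
        rw [add_mul, one_mul, ← div_eq_inv_mul]
        linarith
    _ = _ := by rw [ENNReal.ofReal_mul (by positivity), hK, ENNReal.ofReal_toReal htop]

lemma eqOn_of_isBohrAP (hpos : S.IsPositive) (hf : S.IncrementalBound) (hH : S.H1 ξ p)
    (hx : IsBohrAP (Ici 0) x) (hz : IsBohrAP (Ici 0) z)
    (htx : S.IsTrajectory (Ici 0) w x) (htz : S.IsTrajectory (Ici 0) w z) :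
    EqOn x z (Ici 0) := by
  intro t ht
  obtain ⟨C, hC, hCp⟩ := exists_norm_le_wabs hH.2.1
  have h1 := wabs_sub_le_of_isBohrAP hpos hf hH hx hz htx htz le_rfl
    (fun a _ => by simp [wabs_zero]) ht
  rw [zero_div] at h1
  have h2 := (hCp (x t - z t)).trans (mul_nonpos_of_nonneg_of_nonpos hC.le h1)
  exact sub_eq_zero.1 (norm_le_zero_iff.1 h2)

/-- A bounded trajectory on the line is determined by its input. -/
lemma eq_of_bounded (hpos : S.IsPositive) (hf : S.IncrementalBound) (hH : S.H1 ξ p)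
    (htx : S.IsTrajectory univ w x) (htz : S.IsTrajectory univ w z)
    (hx : ∃ M, ∀ t, ‖x t‖ ≤ M) (hz : ∃ M, ∀ t, ‖z t‖ ≤ M) : x = z := by
  obtain ⟨M, hM⟩ := hx
  obtain ⟨M', hM'⟩ := hz
  obtain ⟨C, hC, hCp⟩ := exists_norm_le_wabs hH.2.1
  funext t
  have h1 := wabs_le_of_bounded hpos hf hH htx htz le_rfl (fun a => by simp [wabs_zero])
    (fun t => (norm_sub_le _ _).trans (add_le_add (hM t) (hM' t))) t
  rw [zero_div] at h1
  have h2 := (hCp (x t - z t)).trans (mul_nonpos_of_nonneg_of_nonpos hC.le h1)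
  exact sub_eq_zero.1 (norm_le_zero_iff.1 h2)

lemma IsTrajectory.continuous (h : S.IsTrajectory univ w x) : Continuous x := by
  refine continuous_iff_continuousAt.2 fun t => ?_
  have h1 := (h.2.1 (t - 1) (mem_univ _) (t + 1) (mem_univ _)).continuousOn
  rw [uIcc_of_le (by linarith)] at h1
  exact h1.continuousAt (Icc_mem_nhds (by linarith) (by linarith))

lemma IsTrajectory.restrict_of_ae_eq {we : ℝ → Fin m₂ → ℝ} (h : S.IsTrajectory univ we x)
    (hw : LocallyIntegrableOn w (Ici 0))
    (hwe : ∀ᵐ t ∂(volume.restrict (Ici (0 : ℝ))), we t = w t) : S.IsTrajectory (Ici 0) w x := by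
  have h1 := h.mono (subset_univ (Ici 0))
  refine ⟨hw, h1.2.1, ?_⟩
  filter_upwards [h1.2.2, hwe] with t ht ht'
  rwa [ht'] at ht

end LureSystem

/-- An almost periodic function on the line is the extension of its restriction to the half-line. -/
lemma IsBohrAP.isBohrExtension_self {n : ℕ} {z : ℝ → Fin n → ℝ} (hz : IsBohrAP univ z) :
    IsBohrExtension z z := by
  refine ⟨hz, fun _ _ => rfl, fun τ hτ _ t => ?_⟩
  -- the almost periods of the restriction are almost periods on the line
  have h1 : ∀ k, ‖z (t + τ k) - z t‖ ≤ 1 / ((k : ℝ) + 1) := by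
    intro k
    refine le_of_forall_pos_le_add fun ε hε => ?_
    obtain ⟨l, -, h⟩ := hz.2 (ε / 2) (by positivity)
    obtain ⟨σ, hσ, -, hσ'⟩ := h (-t) (mem_univ _)
    have e1 := hσ' t (mem_univ _)
    have e2 := hσ' (t + τ k) (mem_univ _)
    have e3 := (hτ k).2 (t + σ) (mem_Ici.2 (by linarith [hσ.1]))
    rw [add_right_comm] at e2
    calc ‖z (t + τ k) - z t‖
        = ‖(z (t + τ k) - z (t + σ + τ k)) - (z t - z (t + σ)) -
            (z (t + σ) - z (t + σ + τ k))‖ := by congr 1; abel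
      _ ≤ ε / 2 + ε / 2 + 1 / ((k : ℝ) + 1) :=
          (norm_sub_le _ _).trans (add_le_add ((norm_sub_le _ _).trans (add_le_add e2 e1)) e3)
      _ = _ := by ring
  exact tendsto_iff_norm_sub_tendsto_zero.2
    (squeeze_zero (fun _ => norm_nonneg _) h1 tendsto_one_div_add_atTop_nhds_zero_nat)

theorem mainTheorem6 {n m₁ m₂ p₁ p₂ : ℕ} (S : LureSystem n m₁ m₂ p₁ p₂)
    (hpos : S.IsPositive) (hf : S.IncrementalBound)
    (ξ : ℝ) (p : Fin n → ℝ) (hH1 : S.H1 ξ p)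
    (ρ : ℝ) (η : Fin p₁ → ℝ) (hη : S.PerronCondition ρ η) :
    -- existence, uniqueness and statements (1)-(5) for a fixed Stepanov almost periodic `w`
    (∀ w : ℝ → Fin m₂ → ℝ, IsStepanovAP (Ici 0) w →
      ∃ z : ℝ → Fin n → ℝ,
        IsBohrAP (Ici 0) z ∧ S.IsTrajectory (Ici 0) w z ∧
        (∀ z' : ℝ → Fin n → ℝ, IsBohrAP (Ici 0) z' → S.IsTrajectory (Ici 0) w z' →
          EqOn z' z (Ici 0)) ∧
        (∀ ε : ℝ, 0 < ε → ∃ δ : ℝ, 0 < δ ∧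
          stepanovPeriods (Ici 0) w δ ⊆ bohrPeriods (Ici 0) z ε) ∧
        -- convergence of trajectories
        (∀ (v : ℝ → Fin m₂ → ℝ) (x : ℝ → Fin n → ℝ), S.IsTrajectory (Ici 0) v x →
          -- (1)
          (HasStepanovAPPart v w →
            Tendsto (fun t => x t - z t) atTop (𝓝 0) ∧ HasBohrAPPart x z) ∧
          -- (2)(i)
          (IsBohrAP (Ici 0) w → HasBohrAPPart v w →
            HasStepanovAPPart v w ∧
              Tendsto (fun t => x t - z t) atTop (𝓝 0) ∧ HasBohrAPPart x z) ∧
          -- (2)(ii)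
          (MemLp v ∞ (volume.restrict (Ici (0 : ℝ))) →
            MemLp w ∞ (volume.restrict (Ici (0 : ℝ))) →
            Tendsto (fun t : ℝ => eLpNorm (fun θ => v θ - w θ) ∞ (volume.restrict (Ioi t)))
              atTop (𝓝 0) →
            Tendsto (fun t => x t - z t) atTop (𝓝 0) ∧ HasBohrAPPart x z) ∧
          -- (2)(iii)
          (IntegrableOn (fun t => v t - w t) (Ici 0) →
            Tendsto (fun t => x t - z t) atTop (𝓝 0) ∧ HasBohrAPPart x z) ∧
          -- (3)
          (∀ α : ℝ, 0 < α → IsULocVanishing α (fun t => v t - w t) →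
            ∃ M γ : ℝ, 0 < γ ∧ ∀ t : ℝ, 0 ≤ t → ‖x t - z t‖ ≤ M * Real.exp (-γ * t))) ∧
        -- (4)
        (∀ τ : ℝ, 0 < τ → (∀ᵐ t ∂(volume.restrict (Ici (0 : ℝ))), w (t + τ) = w t) →
          ∀ t : ℝ, 0 ≤ t → z (t + τ) = z t) ∧
        -- (5)
        (∃ we : ℝ → Fin m₂ → ℝ, ∃ ze : ℝ → Fin n → ℝ,
          IsStepanovExtension w we ∧ IsBohrExtension z ze ∧ S.IsTrajectory univ we ze ∧
          ∀ x' : ℝ → Fin n → ℝ, S.IsTrajectory univ we x' →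
            (∃ M : ℝ, ∀ t : ℝ, ‖x' t‖ ≤ M) → x' = ze)) ∧
    -- (6), Stepanov norm
    (∃ β₀ : ℝ, 0 < β₀ ∧
      ∀ (v w : ℝ → Fin m₂ → ℝ) (x z : ℝ → Fin n → ℝ),
        IsStepanovAP (Ici 0) v → IsStepanovAP (Ici 0) w →
        IsBohrAP (Ici 0) x → IsBohrAP (Ici 0) z →
        S.IsTrajectory (Ici 0) v x → S.IsTrajectory (Ici 0) w z →
        linftyNormW p (fun t => x t - z t) ≤
          ENNReal.ofReal β₀ * stepanovNormW (p ᵥ* S.B₂) (fun t => v t - w t)) ∧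
    -- (6), supremum norm
    (∃ c₁ : ℝ, 0 < c₁ ∧
      ∀ (v w : ℝ → Fin m₂ → ℝ) (x z : ℝ → Fin n → ℝ),
        IsStepanovAP (Ici 0) v → IsStepanovAP (Ici 0) w →
        IsBohrAP (Ici 0) x → IsBohrAP (Ici 0) z →
        S.IsTrajectory (Ici 0) v x → S.IsTrajectory (Ici 0) w z →
        MemLp v ∞ (volume.restrict (Ici (0 : ℝ))) →
        MemLp w ∞ (volume.restrict (Ici (0 : ℝ))) →
        ∀ r : Fin m₂ → ℝ, p ᵥ* S.B₂ ≤ r →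
          linftyNormW p (fun t => x t - z t) ≤
            ENNReal.ofReal c₁ * linftyNormW r (fun t => v t - w t)) ∧
    -- (7)
    (∀ (ξ' : ℝ) (p' l : Fin n → ℝ) (q : Fin p₂ → ℝ) (r k : Fin m₂ → ℝ),
      S.H2 ξ' p' l q r k →
      ∃ c₂ : ℝ, 0 < c₂ ∧
        ∀ (wa wb : ℝ → Fin m₂ → ℝ) (za zb : ℝ → Fin n → ℝ),
          IsStepanovAP (Ici 0) wa → IsStepanovAP (Ici 0) wb →
          IsBohrAP (Ici 0) za → IsBohrAP (Ici 0) zb →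
          S.IsTrajectory (Ici 0) wa za → S.IsTrajectory (Ici 0) wb zb →
          stepanovNormW q (fun t => S.C₂ *ᵥ za t - S.C₂ *ᵥ zb t) ≤
            ENNReal.ofReal c₂ * stepanovNormW r (fun t => wa t - wb t)) := by
  have hκ : 0 < 1 - Real.exp (-ξ) := by simpa using hH1.1
  refine ⟨fun w hw => ?_, ⟨(1 - Real.exp (-ξ))⁻¹, by positivity, fun v w x z _ _ hx hz htx htz =>
    LureSystem.linftyNormW_sub_le hpos hf hH1 hx hz htx htz⟩,
    ⟨(1 - Real.exp (-ξ))⁻¹, by positivity, fun v w x z _ _ hx hz htx htz _ _ r hr =>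
      (LureSystem.linftyNormW_sub_le hpos hf hH1 hx hz htx htz).trans
        (mul_le_mul_right (stepanovNormW_le_linftyNormW hr _) _)⟩,
    fun ξ' p' l q r k hH2 => ?_⟩
  swap
  · have hκ' : 0 < 1 - Real.exp (-ξ') := by simpa using hH2.1
    exact ⟨(1 - Real.exp (-ξ'))⁻¹ + 1, by positivity, fun wa wb za zb _ _ hx hz htx htz =>
      LureSystem.stepanovNormW_output_sub_le hpos hf hH2 hx hz htx htz⟩
  obtain ⟨we, hwe, hper⟩ := hw.exists_extension
  obtain ⟨z, htz, hzb⟩ := LureSystem.exists_bounded_trajectory hpos hf hH1 hwe.1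
  obtain ⟨C, hC, hCz⟩ := LureSystem.exists_norm_translate_sub_le hpos hf hH1
  have htrans := hCz we z htz hzb
  have hsub : ∀ δ, 0 ≤ δ → stepanovPeriods (Ici 0) w δ ⊆ bohrPeriods (Ici 0) z (C * δ) :=
    fun δ hδ τ hτ => ⟨hτ.1, fun t _ => by
      rw [norm_sub_rev]
      exact htrans δ hδ τ (hper δ hτ) t⟩
  have hsub' : ∀ ε, 0 < ε → ∃ δ : ℝ, 0 < δ ∧
      stepanovPeriods (Ici 0) w δ ⊆ bohrPeriods (Ici 0) z ε := fun ε hε => by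
    refine ⟨ε / C, by positivity, ?_⟩
    have h1 := hsub (ε / C) (by positivity)
    rwa [mul_div_cancel₀ _ hC.ne'] at h1
  have hAPu : IsBohrAP univ z := by
    refine ⟨htz.continuous.continuousOn, fun ε hε => ?_⟩
    obtain ⟨l, hl, h⟩ := hwe.1.2 (ε / C) (by positivity)
    refine ⟨l, hl, fun a ha => (h a ha).mono (inter_subset_inter_right _ fun τ hτ => ?_)⟩
    refine ⟨mem_univ _, fun t _ => ?_⟩
    have h1 := htrans (ε / C) (by positivity) τ hτ t
    rwa [mul_div_cancel₀ _ hC.ne', norm_sub_rev] at h1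
  have hAP : IsBohrAP (Ici 0) z := by
    refine ⟨htz.continuous.continuousOn, fun ε hε => ?_⟩
    obtain ⟨δ, hδ, hδε⟩ := hsub' ε hε
    obtain ⟨l, hl, h⟩ := hw.2 δ hδ
    exact ⟨l, hl, fun a ha => (h a ha).mono (inter_subset_inter_right _ hδε)⟩
  have htz0 : S.IsTrajectory (Ici 0) w z := htz.restrict_of_ae_eq hw.1 hwe.2.1
  refine ⟨z, hAP, htz0, fun z' hz' htz' =>
    LureSystem.eqOn_of_isBohrAP hpos hf hH1 hz' hAP htz' htz0, hsub', fun v x htx => ?_,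
    fun τ hτ hwτ t ht => ?_, we, z, hwe, hAPu.isBohrExtension_self, htz, fun x' htx' hx' =>
    LureSystem.eq_of_bounded hpos hf hH1 htx' htz hx' hzb⟩
  · have hconv : Tendsto (fun a : ℝ => ∫⁻ θ in Icc a (a + 1), ‖v θ - w θ‖ₑ) atTop (𝓝 0) →
        Tendsto (fun t => x t - z t) atTop (𝓝 0) ∧ HasBohrAPPart x z := fun h => by
      have h1 := LureSystem.tendsto_sub_of_tendsto_lintegral hpos hf hH1 htx htz0 h
      exact ⟨h1, hAP, htx.continuousOn.sub htz0.continuousOn, h1⟩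
    have hstep : HasStepanovAPPart v w →
        Tendsto (fun t => x t - z t) atTop (𝓝 0) ∧ HasBohrAPPart x z := fun h =>
      hconv (by simpa using h.2.tendsto_lintegral)
    refine ⟨hstep, fun _ hv => ?_, fun _ _ h => hconv (tendsto_lintegral_of_tendsto_eLpNorm_top h),
      fun h => hconv (tendsto_lintegral_of_integrableOn h), fun α hα h => ?_⟩
    · have h1 : HasStepanovAPPart v w := ⟨hw, isULocVanishing_zero_of_tendsto hv.2.1 hv.2.2⟩
      exact ⟨h1, hstep h1⟩
    · exact LureSystem.exists_exp_bound hpos hf hH1 htx htz0 hα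
        (h.tendsto_lintegral.eventually_le_const one_pos)
  · -- a period of `w` is an almost period of `w` with error zero
    have hmem : τ ∈ stepanovPeriods (Ici 0) w 0 := by
      refine ⟨hτ.le, iSup₂_le fun a ha => ?_⟩
      rw [ENNReal.ofReal_zero]
      refine le_of_eq ((lintegral_congr_ae ?_).trans lintegral_zero)
      refine ae_mono (Measure.restrict_mono_set _ fun θ hθ => (mem_Ici.1 ha).trans hθ.1) ?_
      filter_upwards [hwτ] with θ hθ
      simp [hθ]
    have h1 := htrans 0 le_rfl τ (hper 0 hmem) t
    rw [mul_zero] at h1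
    exact sub_eq_zero.1 (norm_le_zero_iff.1 h1)
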